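/- Setting. Let $\mathcal T$ be a compact subset of a Euclidean space with a finite Borel measure $dt$ (for instance Lebesgue measure), and $\mathcal L_2=\mathcal L_2(\mathcal T,dt)$. Let $\mathcal H$ be a reproducing kernel Hilbert space of square integrable real functions on $\mathcal T$, $\mathcal H_0\subset\mathcal H$ a finite-dimensional subspace, $\mathcal H_1$ its orthogonal complement, and $J(f)=\|f_1\|_{\mathcal H}^2$, where $f_1$ is the component of $f$ in $\mathcal H_1$. Assume that the reproducing kernel $K$ of $\mathcal H_1$ is continuous, and let $\rho_1\ge\rho_2\ge\cdots>0$ and $\psi_1,\psi_2,\ldots$ be the eigenvalues and orthonormal eigenfunctions of its integral operator on $\mathcal L_2$ (which vanishes on the orthogonal complement of the $\psi_k$), with $\rho_k\asymp k^{-2r}$, $r>1/2$. Let $s>1/2$, $M\in\mathbb R$, $A>0$, $M_2>0$, $B>0$, $\alpha_0\in\mathbb R$. We observe $n$ independent copies $(X_i,Y_i)$ of $(X,Y)$, $Y=\alpha_0+\int_{\mathcal T} X\beta_0+\varepsilon$, where $X\sim F$ is a random element of $\mathcal L_2$ with $E\|X\|_{\mathcal L_2}^2<\infty$ and $\varepsilon\sim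 G$ is independent of $X$ with $E\varepsilon=0$ and $\operatorname{Var}\varepsilon\le M_2$. Let $\mathcal F(s,M,K)$ be the class of distributions $F$ whose covariance function $C$ is continuous, with $Cf\ne0$ for all $0\ne f\in\mathcal H_0$, and which satisfy: (a) the eigenvalues $\mu_1\ge\mu_2\ge\cdots$ of $C$ satisfy $A^{-1}k^{-2s}\le\mu_k\le Ak^{-2s}$ for all $k\ge 1$; (b) $E\langle f,X-EX\rangle^4\le M\,(E\langle f,X-EX\rangle^2)^2<\infty$ for all $f\in\mathcal L_2$; (c) if $R$ is the operator on $\mathcal L_2$ of the reproducing kernel of $\mathcal H$ with the norm $\|f\|_R^2=\langle Cf,f\rangle_{\mathcal L_2}+J(f)$, then the $k$th largest eigenvalue of $R^{1/2}CR^{1/2}$ is $\nu_k=(1+\gamma_k^{-1})^{-1}$ with $0<\gamma_k<\infty$ and $A^{-1}\rho_k\mu_k\le\gamma_k\le A\rho_k\mu_k$, for all $k\ge 1$. Let $\mathcal F_\psi$ be the set of those $F\in\mathcal F(s,M,K)$ for which the eigenfunctions of $C$ are $\phi_k=\psi_k$ for all $k\ge1$, and assume that $\mathcal F_\psi$ is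 not empty. Statement. The minimax rate for the squared $\mathcal L_2$ estimation error of the slope over $F\in\mathcal F_\psi$, all such $G$, and $\beta_0\in\mathcal H$ with $J(\beta_0)\le B$, is $n^{-2r/(2(r+s)+1)}$, in the following sense. (1) There is a constant $\delta>0$ such that $$\liminf_{n\to\infty}\ \inf_{\tilde\beta}\ \sup_{F,G,\beta_0}P\Bigl(\|\tilde\beta-\beta_0\|_{\mathcal L_2}^2>\delta\, n^{-\frac{2r}{2(r+s)+1}}\Bigr)>0,$$ where the infimum is over all measurable $\mathcal L_2$-valued functions $\tilde\beta$ of the observations. (2) If $\lambda=\lambda_n>0$ and $\lambda_n\asymp n^{-2(r+s)/(2(r+s)+1)}$, then for all $n$ and all data there is exactly one $\hat\beta_{n\lambda}\in\mathcal H$ which, together with some $\hat\alpha\in\mathbb R$, minimizes $\frac1n\sum_{i=1}^n\bigl[Y_i-\alpha-\int_{\mathcal T} X_i\beta\bigr]^2+\lambda J(\beta)$ over $(\alpha,\beta)\in\mathbb R\times\mathcal H$; it is a measurable function of the data (as an element of $\mathcal L_2$), and it achieves the rate: $$\lim_{D\to\infty}\ \limsup_{n\to\infty}\ \sup_{F,G,\beta_0}P\Bigl(\|\hat\beta_{n\lambda}-\beta_0\|_{\mathcal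 L_2}^2>D\, n^{-\frac{2r}{2(r+s)+1}}\Bigr)=0.$$ -/

import Mathlib

open MeasureTheory ProbabilityTheory Filter Topology
open scoped RealInnerProductSpace ENNReal

namespace FLR

/-- `L2 τ` is the space of (classes of) square integrable real functions on the domain, where `τ`
is the reference measure (the `dt` of all integrals). -/
abbrev L2 {T : Type*} [MeasurableSpace T] (τ : Measure T) : Type _ := Lp ℝ 2 τ

/-- `L2 τ` carries its Borel sigma-algebra. -/
noncomputable instance instMeasurableSpaceL2 {T : Type*} [MeasurableSpace T] (τ : Measure T) :
    MeasurableSpace (L2 τ) := borel _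

instance instBorelSpaceL2 {T : Type*} [MeasurableSpace T] (τ : Measure T) :
    BorelSpace (L2 τ) := ⟨rfl⟩

section Operators

variable {T : Type*} [MeasurableSpace T]

/-- `A` is the integral operator `(A f)(s) = ∫ k(s,t) f(t) dt`. -/
def IsIntegralOperator (τ : Measure T) (k : T → T → ℝ) (A : L2 τ →L[ℝ] L2 τ) : Prop :=
  ∀ f : L2 τ, A f =ᵐ[τ] fun s => ∫ t, k s t * f t ∂τ

/-- Spectral decomposition `A = ∑ₖ eₖ ⟨uₖ, ·⟩ uₖ` with `e₀ ≥ e₁ ≥ ⋯` (each eigenvalue repeated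
according to its multiplicity): the `uₖ` are orthonormal eigenvectors, and `A` vanishes on their
orthogonal complement. The index `k : ℕ` corresponds to `k + 1` in the usual numbering. -/
structure IsEigenSystem {E : Type*} [NormedAddCommGroup E] [InnerProductSpace ℝ E]
    (A : E →L[ℝ] E) (e : ℕ → ℝ) (u : ℕ → E) : Prop where
  orthonormal : Orthonormal ℝ u
  antitone : Antitone e
  apply_eq : ∀ k, A (u k) = e k • u k
  complete : ∀ f, (∀ k, ⟪u k, f⟫ = 0) → A f = 0

/-- The covariance operator `C` of the distribution `F` of a random element `X` of `L2 τ`: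
`⟨C f, g⟩ = Cov(⟨f, X⟩, ⟨g, X⟩)`. -/
noncomputable def covOp {τ : Measure T} (F : Measure (L2 τ)) : L2 τ →L[ℝ] L2 τ :=
  InnerProductSpace.continuousLinearMapOfBilin (covarianceBilin F)

end Operators

section Penalty

variable {T : Type*} {H : Type*} [NormedAddCommGroup H] [InnerProductSpace ℝ H]

/-- The component of `f` in the orthogonal complement `H₁` of `H₀`. -/
noncomputable def pen (H₀ : Submodule ℝ H) [H₀.HasOrthogonalProjection] (f : H) : H :=
  f - H₀.starProjection f

/-- The penalty functional: the squared seminorm `J(f) = ‖f₁‖²` with null space `H₀`. -/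
noncomputable def J (H₀ : Submodule ℝ H) [H₀.HasOrthogonalProjection] (f : H) : ℝ :=
  ‖pen H₀ f‖ ^ 2

/-- The reproducing kernel `K` of `H₁`: `K(·,t)` is the `H₁`-component of the representer in `H`
of the evaluation at `t`. -/
noncomputable def penKernel [CompleteSpace H] [RKHS ℝ H T ℝ]
    (H₀ : Submodule ℝ H) [H₀.HasOrthogonalProjection] (s t : T) : ℝ :=
  pen H₀ (RKHS.kerFun H t (1 : ℝ)) s

/-- The class in `L2 τ` of a function in `H`. -/
noncomputable def toL2 [RKHS ℝ H T ℝ] [MeasurableSpace T] {τ : Measure T}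
    (hH : ∀ f : H, MemLp (f : T → ℝ) 2 τ) (f : H) : L2 τ :=
  (hH f).toLp f

/-- The inner product `⟨f, g⟩_R = ⟨C f, g⟩_{L2} + J(f, g)` of the norm `‖f‖_R² = ⟨C f, f⟩ + J(f)`. -/
noncomputable def innerR [RKHS ℝ H T ℝ] [MeasurableSpace T] {τ : Measure T}
    (hH : ∀ f : H, MemLp (f : T → ℝ) 2 τ) (H₀ : Submodule ℝ H) [H₀.HasOrthogonalProjection]
    (C : L2 τ →L[ℝ] L2 τ) (f g : H) : ℝ :=
  ⟪C (toL2 hH f), toL2 hH g⟫ + ⟪pen H₀ f, pen H₀ g⟫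

/-- `R` is the operator on `L2 τ` attached to the reproducing kernel of `(H, ‖·‖_R)`, that is,
`R f ∈ H` and `⟨R f, g⟩_R = ⟨f, g⟩_{L2}` for all `f ∈ L2` and `g ∈ H`. -/
def IsKernelOperatorR [RKHS ℝ H T ℝ] [MeasurableSpace T] {τ : Measure T}
    (hH : ∀ f : H, MemLp (f : T → ℝ) 2 τ) (H₀ : Submodule ℝ H) [H₀.HasOrthogonalProjection]
    (C R : L2 τ →L[ℝ] L2 τ) : Prop :=
  ∀ f : L2 τ, ∃ h : H, toL2 hH h = R f ∧ ∀ g : H, innerR hH H₀ C h g = ⟪f, toL2 hH g⟫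

end Penalty

section Model

variable {T : Type*} [MeasurableSpace T] {τ : Measure T}
  {H : Type*} [NormedAddCommGroup H] [InnerProductSpace ℝ H] [RKHS ℝ H T ℝ]

/-- The positive numbers `γₖ` obtained from the simultaneous diagonalization of `K` and `C`:
`νₖ = (1 + γₖ⁻¹)⁻¹` is the `k`-th largest eigenvalue of `R^{1/2} C R^{1/2}`. -/
def IsSimDiag (hH : ∀ f : H, MemLp (f : T → ℝ) 2 τ) (H₀ : Submodule ℝ H)
    [H₀.HasOrthogonalProjection] (C : L2 τ →L[ℝ] L2 τ) (γ : ℕ → ℝ) : Prop :=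
  (∀ k, 0 < γ k) ∧
  ∃ R S : L2 τ →L[ℝ] L2 τ, IsKernelOperatorR hH H₀ C R ∧ S.IsPositive ∧ S ∘L S = R ∧
    ∃ ζ : ℕ → L2 τ, IsEigenSystem (S ∘L C ∘L S) (fun k => (1 + (γ k)⁻¹)⁻¹) ζ

/-- The class `𝓕(s, M, K)` of distributions `F` of the process `X`; `ρ` is the sequence of the
eigenvalues of `K`, and `A` is the constant in the relations `≍`. -/
structure ProcessClass [TopologicalSpace T] (hH : ∀ f : H, MemLp (f : T → ℝ) 2 τ)
    (H₀ : Submodule ℝ H) [H₀.HasOrthogonalProjection] (ρ : ℕ → ℝ) (s M A : ℝ)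
    (F : Measure (L2 τ)) : Prop where
  prob : IsProbabilityMeasure F
  memLp : MemLp id 2 F
  /-- the covariance function is continuous -/
  continuous_cov : ∃ c : T → T → ℝ, Continuous (Function.uncurry c) ∧
    IsIntegralOperator τ c (covOp F)
  /-- `C f ≠ 0` for nonzero `f` in the null space of the penalty -/
  nondegenerate : ∀ f ∈ H₀, f ≠ 0 → covOp F (toL2 hH f) ≠ 0
  /-- the fourth moments of linear functionals are finite and controlled by the second moments -/
  fourth_moment : ∀ f : L2 τ, Integrable (fun x => ⟪f, x - ∫ x', x' ∂F⟫ ^ 4) F ∧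
    ∫ x, ⟪f, x - ∫ x', x' ∂F⟫ ^ 4 ∂F ≤ M * (∫ x, ⟪f, x - ∫ x', x' ∂F⟫ ^ 2 ∂F) ^ 2
  /-- `μₖ ≍ k^{-2s}` for the eigenvalues of `C`, and `γₖ ≍ ρₖ μₖ` -/
  decay : ∃ (μ : ℕ → ℝ) (φ : ℕ → L2 τ) (γ : ℕ → ℝ),
    IsEigenSystem (covOp F) μ φ ∧
    (∀ k : ℕ, A⁻¹ * ((k : ℝ) + 1) ^ (-2 * s) ≤ μ k ∧ μ k ≤ A * ((k : ℝ) + 1) ^ (-2 * s)) ∧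
    IsSimDiag hH H₀ (covOp F) γ ∧
    (∀ k : ℕ, A⁻¹ * (ρ k * μ k) ≤ γ k ∧ γ k ≤ A * (ρ k * μ k))

/-- The members of `𝓕(s, M, K)` whose covariance operator has the eigenfunctions `φₖ = ψₖ`. -/
def commonClass [TopologicalSpace T] (hH : ∀ f : H, MemLp (f : T → ℝ) 2 τ)
    (H₀ : Submodule ℝ H) [H₀.HasOrthogonalProjection] (ρ : ℕ → ℝ) (ψ : ℕ → L2 τ) (s M A : ℝ) :
    Set (Measure (L2 τ)) :=
  {F | ProcessClass hH H₀ ρ s M A F ∧ ∃ μ : ℕ → ℝ, IsEigenSystem (covOp F) μ ψ}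

/-- The distributions of a centered noise variable with variance at most `M₂`. -/
def noiseClass (M₂ : ℝ) : Set (Measure ℝ) :=
  {G | IsProbabilityMeasure G ∧ MemLp id 2 G ∧ ∫ e, e ∂G = 0 ∧ ∫ e, e ^ 2 ∂G ≤ M₂}

/-- The joint law of `n` independent copies of `(X, Y)`, where `Y = α₀ + ∫ X β₀ + ε`, `X ∼ F` and
`ε ∼ G` is independent of `X`. -/
noncomputable def dataLaw (n : ℕ) (α₀ : ℝ) (β₀ : L2 τ) (F : Measure (L2 τ)) (G : Measure ℝ) :
    Measure (Fin n → L2 τ × ℝ) :=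
  Measure.pi fun _ => (F.prod G).map fun p => (p.1, α₀ + ⟪p.1, β₀⟫ + p.2)

/-- The regularized least squares criterion
`n⁻¹ ∑ᵢ (yᵢ - (α + ∫ xᵢ β))² + lam J(β)`. -/
noncomputable def criterion (hH : ∀ f : H, MemLp (f : T → ℝ) 2 τ) (H₀ : Submodule ℝ H)
    [H₀.HasOrthogonalProjection] (n : ℕ) (lam : ℝ) (z : Fin n → L2 τ × ℝ) (α : ℝ) (β : H) : ℝ :=
  (1 / (n : ℝ)) * ∑ i, ((z i).2 - (α + ⟪(z i).1, toL2 hH β⟫)) ^ 2 + lam * J H₀ β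

/-- `β` is a regularized estimate of the slope: together with some `α` it minimizes the
criterion over `ℝ × H`. -/
def IsRegularizedSlope (hH : ∀ f : H, MemLp (f : T → ℝ) 2 τ) (H₀ : Submodule ℝ H)
    [H₀.HasOrthogonalProjection] (n : ℕ) (lam : ℝ) (z : Fin n → L2 τ × ℝ) (β : H) : Prop :=
  ∃ α : ℝ, ∀ (α' : ℝ) (β' : H),
    criterion hH H₀ n lam z α β ≤ criterion hH H₀ n lam z α' β'

/-- The worst case probability, over `F ∈ 𝓕`, noise laws in `𝓖` and slopes `β₀ ∈ 𝓑`, that the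
squared `L2` error of the estimator `b` exceeds `u`. -/
noncomputable def worstProb (hH : ∀ f : H, MemLp (f : T → ℝ) 2 τ) (n : ℕ) (α₀ : ℝ)
    (𝓕 : Set (Measure (L2 τ))) (𝓖 : Set (Measure ℝ)) (𝓑 : Set H)
    (b : (Fin n → L2 τ × ℝ) → L2 τ) (u : ℝ) : ℝ≥0∞ :=
  ⨆ F ∈ 𝓕, ⨆ G ∈ 𝓖, ⨆ β₀ ∈ 𝓑,
    dataLaw n α₀ (toL2 hH β₀) F G {z | u < ‖b z - toL2 hH β₀‖ ^ 2}

end Model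

end FLR

/-! The classes force the penalty to have trivial null space. A nonzero element of `H₀` would
produce an eigenvector of `R^{1/2} C R^{1/2}` with eigenvalue `1`, while every `νₖ = (1 + γₖ⁻¹)⁻¹`
is below `1` and the operator vanishes off its eigenvectors (`nullSpace_eq_bot`). Hence `J` is the
squared norm of `H`, and the integral operator of `K` factors as `ι ι*`, with `ι` the embedding of
`H` into `L2` (`exists_embedding`). Both `ι ι*` and `C` are then diagonal in `ψ`: `‖β‖²` dominates
`∑ ⟨ψₖ, β⟩² / ρₖ`, with equality for suitable finite combinations, and `⟨C β, β⟩ = ∑ μₖ ⟨ψₖ, β⟩²`.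
Put `p = 2(r + s)` and `N = n^{1/(p+1)}`.

Lower bound. Fix one centered `F` and Gaussian noise of variance `M₂`, and take slopes `∑ θⱼ cⱼ
ψ_{m+j}` with `j < m`, `θ ∈ {0,1}^m`, `cⱼ² = B ρ_{m+j} / m` and `m ≍ N`. Their penalty is at most
`B`. Changing one `θⱼ` moves the `n`-sample law by a bounded Hellinger amount, because `n cⱼ²
μ_{m+j} ≲ n m^{-p-1} ≲ 1`. Assouad's argument (`dataLaw_hypercube`) gives a squared error of order
`m · m^{-2r-1} = m^{-2r}`.

Upper bound. Measure the error in the norm with weights `wₖ = μₖ + λ / ρₖ`, adding the intercept as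
a coordinate of weight `1`. If the empirical second moments are within `1/4` of the diagonal
population moments in the weighted Hilbert–Schmidt norm, the basic inequality bounds the weighted
error by the weighted noise plus `λ B` (`weighted_oracle_bound`). By Markov's inequality
(`empirical_moments_bound`) this event fails with probability of order `S² / n`, and the weighted
noise has mean of order `S / n`, where `S = 1 + ∑ μₖ / wₖ`. With `λ = L^{-p}` and `L ≍ N`,
`effective_dimension_bound` gives `S ≲ N`, so `S² / n → 0` and `S / n ≍ λ` at most. Finally `wₖ ≳
L^{-2s}` (`weight_lower_bound`), so the squared `L2` error is of order `L^{-p} / L^{-2s} = L^{-2r}`.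
-/

namespace FLR

/-! ### Testing two product measures: Hellinger affinity -/

section TwoPoint

variable {Z : Type*} [MeasurableSpace Z]

theorem lintegral_pi_prod {n : ℕ} (P : Measure Z) [IsProbabilityMeasure P]
    (f : Fin n → Z → ℝ≥0∞) (hf : ∀ i, Measurable (f i)) :
    ∫⁻ z, ∏ i, f i (z i) ∂(Measure.pi fun _ : Fin n => P) = ∏ i, ∫⁻ z, f i z ∂P := by
  have h := lintegral_prod_eq_prod_lintegral_of_indepFun
    (μ := Measure.pi fun _ : Fin n => P) Finset.univ (fun i z => f i (z i))
    (iIndepFun_pi fun i => (hf i).aemeasurable)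
    (fun i => (hf i).comp (measurable_pi_apply i))
  rw [h]
  refine Finset.prod_congr rfl fun i _ => ?_
  rw [← (measurePreserving_eval (fun _ : Fin n => P) i).lintegral_comp (hf i)]

theorem pi_withDensity {n : ℕ} (P : Measure Z) [IsProbabilityMeasure P] {L : Z → ℝ≥0∞}
    (hL : Measurable L) [SigmaFinite (P.withDensity L)] :
    Measure.pi (fun _ : Fin n => P.withDensity L)
      = (Measure.pi fun _ : Fin n => P).withDensity fun z => ∏ i, L (z i) := by
  refine Measure.pi_eq fun s hs => ?_
  rw [withDensity_apply _ (MeasurableSet.univ_pi hs),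
    ← lintegral_indicator (MeasurableSet.univ_pi hs)]
  have : ∀ z : Fin n → Z, (Set.univ.pi s).indicator (fun z => ∏ i, L (z i)) z
      = ∏ i, (s i).indicator L (z i) := by
    intro z
    by_cases hz : z ∈ Set.univ.pi s
    · rw [Set.indicator_of_mem hz]
      exact Finset.prod_congr rfl fun i _ => (Set.indicator_of_mem (hz i trivial) _).symm
    · rw [Set.indicator_of_notMem hz]
      obtain ⟨i, hi⟩ : ∃ i, z i ∉ s i := by simpa using hz
      exact (Finset.prod_eq_zero (Finset.mem_univ i) (Set.indicator_of_notMem hi _)).symm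
  simp_rw [this]
  rw [lintegral_pi_prod P _ fun i => hL.indicator (hs i)]
  refine Finset.prod_congr rfl fun i _ => ?_
  rw [lintegral_indicator (hs i), withDensity_apply _ (hs i)]

/-- A lower bound for the sum of the error probabilities of a test between the `n`-fold powers of
`P` and of `Q = g² P`, in terms of the Hellinger affinity `∫ g dP`. -/
theorem two_point_bound {n : ℕ} (P Q : Measure Z) [IsProbabilityMeasure P]
    [IsProbabilityMeasure Q] {g : Z → ℝ} (hg : Measurable g) (hg0 : ∀ z, 0 ≤ g z)
    (hQ : Q = P.withDensity fun z => ENNReal.ofReal (g z ^ 2))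
    (ha : 1 / 2 ≤ (∫⁻ z, ENNReal.ofReal (g z) ∂P) ^ n)
    {S : Set (Fin n → Z)} (hS : MeasurableSet S) :
    1 / 8 ≤ (Measure.pi fun _ : Fin n => P) S + (Measure.pi fun _ : Fin n => Q) Sᶜ := by
  set PP := Measure.pi fun _ : Fin n => P
  set G : (Fin n → Z) → ℝ := fun z => ∏ i, g (z i) with hG
  have hGm : Measurable G := by fun_prop
  have hG0 : ∀ z, 0 ≤ G z := fun z => Finset.prod_nonneg fun i _ => hg0 _
  have hL : Measurable fun z => ENNReal.ofReal (g z ^ 2) := by fun_prop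
  have hGL : Measurable fun z => ENNReal.ofReal (G z ^ 2) := by fun_prop
  have hQQ : Measure.pi (fun _ : Fin n => Q)
      = PP.withDensity fun z => ENNReal.ofReal (G z ^ 2) := by
    subst hQ
    rw [pi_withDensity P hL]
    congr 1
    funext z
    rw [← ENNReal.ofReal_prod_of_nonneg fun i _ => sq_nonneg _, hG, Finset.prod_pow]
  have hGint : ∫⁻ z, ENNReal.ofReal (G z) ∂PP = (∫⁻ z, ENNReal.ofReal (g z) ∂P) ^ n := by
    have := lintegral_pi_prod (n := n) P (fun _ z => ENNReal.ofReal (g z)) (by fun_prop)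
    simp only [Finset.prod_const, Finset.card_univ, Fintype.card_fin] at this
    rw [← this]
    refine lintegral_congr fun z => ?_
    rw [← ENNReal.ofReal_prod_of_nonneg fun i _ => hg0 _]
  have hG2 : ∫⁻ z, ENNReal.ofReal (G z ^ 2) ∂PP = 1 := by
    have : (Measure.pi fun _ : Fin n => Q) Set.univ = 1 := measure_univ
    rwa [hQQ, withDensity_apply _ MeasurableSet.univ, Measure.restrict_univ] at this
  have hsum : PP S + (Measure.pi fun _ : Fin n => Q) Sᶜ
      = ∫⁻ z, (S.indicator 1 z + Sᶜ.indicator (fun z => ENNReal.ofReal (G z ^ 2)) z) ∂PP := by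
    rw [lintegral_add_left (measurable_one.indicator hS), lintegral_indicator_one hS,
      lintegral_indicator hS.compl, hQQ, withDensity_apply _ hS.compl]
  -- On `S` this is `(G - 4)² ≥ 0`; on the complement it follows from `(G - 1/4)² ≥ 0`. Integrating,
  -- with `∫ G² = 1`, gives `1/2 ≤ 2 · (sum of errors) + 1/4`.
  have hpt : ∀ z, ENNReal.ofReal (G z) ≤
      2 * (S.indicator 1 z + Sᶜ.indicator (fun z => ENNReal.ofReal (G z ^ 2)) z)
        + (1 / 8 + 1 / 8 * ENNReal.ofReal (G z ^ 2)) := by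
    intro z
    have h8 : (1 / 8 : ℝ≥0∞) = ENNReal.ofReal (1 / 8) := by
      rw [ENNReal.ofReal_div_of_pos (by norm_num)]; simp
    have h2 : (2 : ℝ≥0∞) = ENNReal.ofReal 2 := by simp
    have hz := hG0 z
    by_cases h : z ∈ S
    · rw [Set.indicator_of_mem h, Set.indicator_of_notMem (by simpa using h), h8, h2,
        Pi.one_apply, ← ENNReal.ofReal_one, add_zero, ← ENNReal.ofReal_mul (by norm_num),
        ← ENNReal.ofReal_mul (by norm_num), ← ENNReal.ofReal_add (by norm_num) (by positivity),
        ← ENNReal.ofReal_add (by norm_num) (by positivity)]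
      apply ENNReal.ofReal_le_ofReal
      nlinarith [sq_nonneg (G z - 4)]
    · rw [Set.indicator_of_notMem h, Set.indicator_of_mem (by simpa using h), h8, h2,
        zero_add, ← ENNReal.ofReal_mul (by norm_num),
        ← ENNReal.ofReal_mul (by norm_num), ← ENNReal.ofReal_add (by norm_num) (by positivity),
        ← ENNReal.ofReal_add (by positivity) (by positivity)]
      apply ENNReal.ofReal_le_ofReal
      nlinarith [sq_nonneg (G z - 1 / 4)]
  have hint := lintegral_mono (μ := PP) hpt
  rw [hGint, lintegral_add_right _ (by fun_prop), lintegral_const_mul _ (f := fun z =>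
    S.indicator 1 z + Sᶜ.indicator (fun z => ENNReal.ofReal (G z ^ 2)) z)
    ((measurable_one.indicator hS).add (hGL.indicator hS.compl)), ← hsum,
    lintegral_add_left (by fun_prop), lintegral_const_mul _ hGL, hG2, lintegral_const,
    measure_univ] at hint
  have h := ha.trans hint
  by_cases htop : PP S + (Measure.pi fun _ : Fin n => Q) Sᶜ = ∞
  · rw [htop]; exact le_top
  lift PP S + (Measure.pi fun _ : Fin n => Q) Sᶜ to NNReal using htop with x
  have h' := ENNReal.toReal_mono (by finiteness) h
  rw [ENNReal.toReal_add (by finiteness) (by finiteness)] at h'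
  simp at h'
  rw [show (1 / 8 : ℝ≥0∞) = ENNReal.ofReal (1 / 8) by
      rw [ENNReal.ofReal_div_of_pos (by norm_num)]; simp]
  apply ENNReal.ofReal_le_of_le_toReal
  simp only [ENNReal.coe_toReal]
  rw [ENNReal.toReal_add (by finiteness) (by finiteness)] at h'
  simp at h'
  linarith

end TwoPoint

/-! ### Likelihood ratio and affinity for shifted Gaussian noise -/

section GaussianShift

variable {E : Type*} [MeasurableSpace E]

/-- The likelihood ratio is displayed as a square because its root is the function `g` whose
integral is the Hellinger affinity. -/
theorem gaussianReal_shift {v : NNReal} (hv : v ≠ 0) (t : ℝ) :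
    gaussianReal t v = (gaussianReal 0 v).withDensity
      fun e => ENNReal.ofReal (Real.exp (e * t / (2 * v) - t ^ 2 / (4 * v)) ^ 2) := by
  rw [gaussianReal_of_var_ne_zero _ hv, gaussianReal_of_var_ne_zero _ hv,
    ← withDensity_mul _ (measurable_gaussianPDF _ _) (by fun_prop)]
  congr 1
  funext e
  have hv' : (v : ℝ) ≠ 0 := by exact_mod_cast hv
  simp only [Pi.mul_apply, gaussianPDF, gaussianPDFReal]
  rw [← ENNReal.ofReal_mul (by positivity), ← Real.exp_nat_mul, mul_assoc, mul_assoc, ← Real.exp_add]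
  congr 3
  push_cast
  field_simp
  ring

theorem map_shift_eq_withDensity (F : Measure E) [IsProbabilityMeasure F] {v : NNReal}
    (hv : v ≠ 0) {φ : E → ℝ} (hφ : Measurable φ) :
    (F.prod (gaussianReal 0 v)).map (fun p => (p.1, p.2 + φ p.1))
      = (F.prod (gaussianReal 0 v)).withDensity fun p =>
        ENNReal.ofReal (Real.exp (p.2 * φ p.1 / (2 * v) - φ p.1 ^ 2 / (4 * v)) ^ 2) := by
  ext S hS
  rw [Measure.map_apply (by fun_prop) hS, Measure.prod_apply (by
    exact (by fun_prop : Measurable fun p : E × ℝ => (p.1, p.2 + φ p.1)) hS),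
    withDensity_apply _ hS, ← lintegral_indicator hS, lintegral_prod _ (by
      refine (Measurable.indicator ?_ hS).aemeasurable
      fun_prop)]
  refine lintegral_congr fun x => ?_
  have hSx : MeasurableSet (Prod.mk x ⁻¹' S) := measurable_prodMk_left hS
  have h1 : Prod.mk x ⁻¹' ((fun p : E × ℝ => (p.1, p.2 + φ p.1)) ⁻¹' S)
      = (fun e => e + φ x) ⁻¹' (Prod.mk x ⁻¹' S) := rfl
  rw [h1, ← Measure.map_apply (by fun_prop) hSx, gaussianReal_map_add_const, zero_add,
    gaussianReal_shift hv, withDensity_apply _ hSx, ← lintegral_indicator hSx]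
  rfl

/-- Integrating out the noise with the Gaussian moment generating function leaves `exp (-φ² / (8
v))`, and `exp (-t) ≥ 1 - t`. -/
theorem lintegral_affinity (F : Measure E) [IsProbabilityMeasure F] {v : NNReal}
    (hv : v ≠ 0) {φ : E → ℝ} (hφ : Measurable φ) (hφ2 : Integrable (fun x => φ x ^ 2) F) :
    ENNReal.ofReal (1 - (∫ x, φ x ^ 2 ∂F) / (8 * v)) ≤
      ∫⁻ p, ENNReal.ofReal (Real.exp (p.2 * φ p.1 / (2 * v) - φ p.1 ^ 2 / (4 * v)))
        ∂(F.prod (gaussianReal 0 v)) := by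
  have hv' : (v : ℝ) ≠ 0 := by exact_mod_cast hv
  rw [lintegral_prod _ (by fun_prop)]
  have hin : ∀ x, ∫⁻ e, ENNReal.ofReal (Real.exp (e * φ x / (2 * v) - φ x ^ 2 / (4 * v)))
      ∂(gaussianReal 0 v) = ENNReal.ofReal (Real.exp (-(φ x ^ 2 / (8 * v)))) := by
    intro x
    have hint : Integrable (fun e => Real.exp ((φ x / (2 * v)) * e)) (gaussianReal 0 v) :=
      integrable_exp_mul_gaussianReal _
    have heq : ∀ e : ℝ, Real.exp (e * φ x / (2 * v) - φ x ^ 2 / (4 * v))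
        = Real.exp (-(φ x ^ 2 / (4 * v))) * Real.exp ((φ x / (2 * v)) * e) := by
      intro e
      rw [← Real.exp_add]; congr 1; ring
    simp_rw [heq]
    rw [← ofReal_integral_eq_lintegral_ofReal (hint.const_mul _)
      (ae_of_all _ fun e => by positivity), integral_const_mul]
    have := mgf_gaussianReal (p := gaussianReal 0 v) (X := id) (μ := 0) (v := v)
      Measure.map_id (φ x / (2 * v))
    simp only [mgf, id] at this
    rw [this, ← Real.exp_add]
    congr 2
    field_simp
    ring
  simp_rw [hin]
  have hI : Integrable (fun x => 1 - φ x ^ 2 / (8 * v)) F :=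
    (integrable_const 1).sub (hφ2.div_const _)
  have : 1 - (∫ x, φ x ^ 2 ∂F) / (8 * v) = ∫ x, (1 - φ x ^ 2 / (8 * v)) ∂F := by
    rw [integral_sub (integrable_const 1) (hφ2.div_const _), integral_div]; simp
  rw [this]
  have hE : Integrable (fun x => Real.exp (-(φ x ^ 2 / (8 * v)))) F := by
    refine Integrable.of_bound (C := 1) (by fun_prop) (ae_of_all _ fun x => ?_)
    rw [Real.norm_of_nonneg (Real.exp_pos _).le]
    exact Real.exp_le_one_iff.2 (neg_nonpos.2 (by positivity))
  rw [← ofReal_integral_eq_lintegral_ofReal hE (ae_of_all _ fun x => (Real.exp_pos _).le)]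
  refine ENNReal.ofReal_le_ofReal (integral_mono hI hE fun x => ?_)
  have := Real.add_one_le_exp (-(φ x ^ 2 / (8 * v)))
  linarith

end GaussianShift

/-! ### The law of the sample and Assouad's lemma -/

section DataLaw

variable {T : Type*} [MeasurableSpace T] {τ : Measure T} [SecondCountableTopology (L2 τ)]

theorem measurable_observation (α₀ : ℝ) (β : L2 τ) :
    Measurable fun p : L2 τ × ℝ => (p.1, α₀ + ⟪p.1, β⟫ + p.2) := by
  fun_prop

instance isProbabilityMeasure_dataLaw (n : ℕ) (α₀ : ℝ) (β : L2 τ) (F : Measure (L2 τ))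
    (G : Measure ℝ) [IsProbabilityMeasure F] [IsProbabilityMeasure G] :
    IsProbabilityMeasure (dataLaw n α₀ β F G) := by
  have : IsProbabilityMeasure ((F.prod G).map fun p : L2 τ × ℝ => (p.1, α₀ + ⟪p.1, β⟫ + p.2)) :=
    Measure.isProbabilityMeasure_map (measurable_observation α₀ β).aemeasurable
  unfold dataLaw
  infer_instance

theorem dataLaw_apply (n : ℕ) (α₀ : ℝ) (β : L2 τ) (F : Measure (L2 τ)) (G : Measure ℝ)
    [IsProbabilityMeasure F] [IsProbabilityMeasure G] {S : Set (Fin n → L2 τ × ℝ)}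
    (hS : MeasurableSet S) :
    dataLaw n α₀ β F G S = (Measure.pi fun _ : Fin n => F.prod G)
      ((fun z i => ((z i).1, α₀ + ⟪(z i).1, β⟫ + (z i).2)) ⁻¹' S) := by
  have : IsProbabilityMeasure ((F.prod G).map fun p : L2 τ × ℝ => (p.1, α₀ + ⟪p.1, β⟫ + p.2)) :=
    Measure.isProbabilityMeasure_map (measurable_observation α₀ β).aemeasurable
  unfold dataLaw
  rw [← Measure.pi_map_pi (fun _ => (measurable_observation α₀ β).aemeasurable),
    Measure.map_apply (by fun_prop) hS]

/-- Two slopes that are close relative to the noise level cannot be told apart. -/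
theorem dataLaw_two_point {n : ℕ} (α₀ : ℝ) (F : Measure (L2 τ)) [IsProbabilityMeasure F]
    (hF : MemLp id 2 F) {v : NNReal} (hv : v ≠ 0) (β β' : L2 τ)
    (hβ : n * ∫ x, ⟪x, β' - β⟫ ^ 2 ∂F ≤ 4 * v) {S : Set (Fin n → L2 τ × ℝ)}
    (hS : MeasurableSet S) :
    1 / 8 ≤ (dataLaw n α₀ β F (gaussianReal 0 v)).real S
      + (dataLaw n α₀ β' F (gaussianReal 0 v)).real Sᶜ := by
  have hvp : (0 : ℝ) < v := by exact_mod_cast pos_iff_ne_zero.2 hv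
  set φ : L2 τ → ℝ := fun x => ⟪x, β' - β⟫
  have hφ : Measurable φ := by fun_prop
  have hφ2 : Integrable (fun x => φ x ^ 2) F := (hF.inner_const (β' - β)).integrable_sq
  set P := F.prod (gaussianReal 0 v)
  set Q := P.map fun p => (p.1, p.2 + φ p.1)
  have hsh : Measurable fun p : L2 τ × ℝ => (p.1, p.2 + φ p.1) := by fun_prop
  have : IsProbabilityMeasure Q := Measure.isProbabilityMeasure_map hsh.aemeasurable
  -- The same map `Φ`, built from `β`, produces both samples: passing to `β'` amounts to shifting
  -- the noise by `φ x = ⟪x, β' - β⟫` beforehand. The test `S` is thus pulled back to a test between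
  -- `P` and `Q`.
  set Φ : (Fin n → L2 τ × ℝ) → (Fin n → L2 τ × ℝ) :=
    fun z i => ((z i).1, α₀ + ⟪(z i).1, β⟫ + (z i).2)
  have hΦ : Measurable Φ := by fun_prop
  have hP : dataLaw n α₀ β F (gaussianReal 0 v) S = (Measure.pi fun _ : Fin n => P) (Φ ⁻¹' S) :=
    dataLaw_apply n α₀ β F _ hS
  have hQ : dataLaw n α₀ β' F (gaussianReal 0 v) Sᶜ
      = (Measure.pi fun _ : Fin n => Q) (Φ ⁻¹' S)ᶜ := by
    rw [dataLaw_apply n α₀ β' F _ hS.compl,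
      ← Measure.pi_map_pi (fun _ => hsh.aemeasurable),
      Measure.map_apply (by fun_prop) (hΦ hS).compl]
    congr 1
    ext z
    simp only [Set.mem_preimage, Set.mem_compl_iff, Φ, φ]
    have : ∀ i, α₀ + ⟪(z i).1, β'⟫ + (z i).2
        = α₀ + ⟪(z i).1, β⟫ + ((z i).2 + ⟪(z i).1, β' - β⟫) := by
      intro i; rw [inner_sub_right]; ring
    simp_rw [this]
  have hint0 : 0 ≤ ∫ x, φ x ^ 2 ∂F := integral_nonneg fun x => sq_nonneg _
  have ha : 1 / 2 ≤ (∫⁻ p, ENNReal.ofReal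
      (Real.exp (p.2 * φ p.1 / (2 * v) - φ p.1 ^ 2 / (4 * v))) ∂P) ^ n := by
    refine le_trans ?_ (pow_le_pow_left' (lintegral_affinity F hv hφ hφ2) n)
    rcases Nat.eq_zero_or_pos n with rfl | hn
    · simp
    have hn' : (1 : ℝ) ≤ n := by exact_mod_cast hn
    set w := (∫ x, φ x ^ 2 ∂F) / (8 * v) with hw
    have hw2 : n * w ≤ 1 / 2 := by
      rw [hw, ← mul_div_assoc, div_le_iff₀ (by positivity)]
      linarith
    have hw0 : 0 ≤ w := by positivity
    have hw1 : w ≤ 1 / 2 := by nlinarith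
    -- Bernoulli's inequality: `(1 - w)ⁿ ≥ 1 - n w ≥ 1/2`.
    have hb := one_add_mul_le_pow (a := -w) (by linarith) n
    rw [← ENNReal.ofReal_pow (by linarith), show (1 / 2 : ℝ≥0∞) = ENNReal.ofReal (1 / 2) by
      rw [ENNReal.ofReal_div_of_pos (by norm_num)]; simp]
    apply ENNReal.ofReal_le_ofReal
    have : (1 + -w) ^ n = (1 - w) ^ n := by ring
    linarith
  have hmain := two_point_bound (n := n) P Q
    (g := fun p => Real.exp (p.2 * φ p.1 / (2 * v) - φ p.1 ^ 2 / (4 * v))) (by fun_prop)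
    (fun _ => (Real.exp_pos _).le) (map_shift_eq_withDensity F hv hφ) ha (hΦ hS)
  rw [← hP, ← hQ] at hmain
  have := ENNReal.toReal_mono (by finiteness) hmain
  rw [ENNReal.toReal_add (by finiteness) (by finiteness)] at this
  simpa [measureReal_def] using this

/-- Assouad's lemma for the functional linear model with Gaussian noise. -/
theorem dataLaw_hypercube {n m : ℕ} (hm : 0 < m) (α₀ : ℝ) (F : Measure (L2 τ))
    [IsProbabilityMeasure F] (hF : MemLp id 2 F) {v : NNReal} (hv : v ≠ 0) {u : Fin m → L2 τ}
    (hu : Orthonormal ℝ u) (c : Fin m → ℝ) {κ : ℝ} (hκ : 0 < κ) (hc : ∀ j, κ ≤ c j ^ 2)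
    (hdist : ∀ j, n * ∫ x, ⟪x, c j • u j⟫ ^ 2 ∂F ≤ 4 * v)
    {b : (Fin n → L2 τ × ℝ) → L2 τ} (hb : Measurable b) :
    ∃ θ : Fin m → Bool, 1 / 32 ≤
      (dataLaw n α₀ (∑ j, (if θ j then c j else 0) • u j) F (gaussianReal 0 v)).real
        {z | κ * m / 128 < ‖b z - ∑ j, (if θ j then c j else 0) • u j‖ ^ 2} := by
  classical
  set β : (Fin m → Bool) → L2 τ := fun θ => ∑ j, (if θ j then c j else 0) • u j with hβ
  set D : (Fin m → Bool) → Measure (Fin n → L2 τ × ℝ) :=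
    fun θ => dataLaw n α₀ (β θ) F (gaussianReal 0 v)
  have hm' : (0 : ℝ) < m := by exact_mod_cast hm
  -- `S j` is the event that coordinate `j` of the estimate is at least as close to `c j` as to `0`;
  -- multiplying by `c j` makes its sign irrelevant. `R θ j` is the event that the resulting test
  -- errs on bit `j`.
  set S : Fin m → Set (Fin n → L2 τ × ℝ) := fun j => {z | c j ^ 2 / 2 ≤ c j * ⟪u j, b z⟫}
  have hS : ∀ j, MeasurableSet (S j) := fun j =>
    measurableSet_le measurable_const (by fun_prop)
  set R : (Fin m → Bool) → Fin m → Set (Fin n → L2 τ × ℝ) :=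
    fun θ j => if θ j then (S j)ᶜ else S j with hR
  have hRm : ∀ θ j, MeasurableSet (R θ j) := by
    intro θ j
    simp only [hR]
    split_ifs
    exacts [(hS j).compl, hS j]
  by_contra! hcon
  -- An error on bit `j` puts coordinate `j` off by at least `|c j| / 2`; Bessel's inequality adds
  -- these up.
  have hcoord : ∀ θ z, ∑ j, (R θ j).indicator (fun _ => (1 : ℝ)) z * (κ / 4) ≤ ‖b z - β θ‖ ^ 2 := by
    intro θ z
    refine le_trans (Finset.sum_le_sum fun j _ => ?_)
      (hu.sum_inner_products_le (b z - β θ) (s := Finset.univ))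
    have hin : ⟪u j, b z - β θ⟫ = ⟪u j, b z⟫ - if θ j then c j else 0 := by
      rw [inner_sub_right, hβ, hu.inner_right_fintype]
    rw [hin, Real.norm_eq_abs, sq_abs]
    have hcj := hc j
    by_cases hz : z ∈ R θ j
    · rw [Set.indicator_of_mem hz]
      have key : (c j ^ 2 / 2) ^ 2 ≤
          c j ^ 2 * (⟪u j, b z⟫ - if θ j then c j else 0) ^ 2 := by
        rw [← mul_pow]
        cases hθ : θ j
        · have : c j ^ 2 / 2 ≤ c j * ⟪u j, b z⟫ := by simpa [hR, hθ, S] using hz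
          simp only [Bool.false_eq_true, if_false, sub_zero]
          exact pow_le_pow_left₀ (by positivity) this 2
        · have : c j * ⟪u j, b z⟫ < c j ^ 2 / 2 := by simpa [hR, hθ, S] using hz
          simp only [if_true]
          rw [← neg_sq (c j * _)]
          refine pow_le_pow_left₀ (by positivity) ?_ 2
          nlinarith
      have hc0 : 0 < c j ^ 2 := hκ.trans_le hcj
      have : c j ^ 2 / 4 ≤ (⟪u j, b z⟫ - if θ j then c j else 0) ^ 2 := by
        by_contra! hlt
        nlinarith [mul_lt_mul_of_pos_left hlt hc0]
      linarith
    · rw [Set.indicator_of_notMem hz, zero_mul]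
      positivity
  -- If the conclusion fails, the expected number of wrong bits is below `m/32 + m/32`: off `W` at
  -- most `m/32` bits are wrong, and `W` has probability below `1/32`.
  have hupper : ∀ θ, ∑ j, (D θ).real (R θ j) < m / 16 := by
    intro θ
    set W := {z | κ * m / 128 < ‖b z - β θ‖ ^ 2}
    have hW : MeasurableSet W := measurableSet_lt measurable_const (by fun_prop)
    have hpt : ∀ z, ∑ j, (R θ j).indicator (fun _ => (1 : ℝ)) z
        ≤ m * W.indicator (fun _ => (1 : ℝ)) z + m / 32 := by
      intro z
      have h1 : ∑ j, (R θ j).indicator (fun _ => (1 : ℝ)) z ≤ m := by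
        calc _ ≤ ∑ j : Fin m, (1 : ℝ) := Finset.sum_le_sum fun j _ =>
              Set.indicator_le_self' (fun _ _ => zero_le_one) z
          _ = m := by simp
      by_cases hz : z ∈ W
      · rw [Set.indicator_of_mem hz]; linarith
      · rw [Set.indicator_of_notMem hz]
        have h2 := hcoord θ z
        rw [← Finset.sum_mul] at h2
        have h3 : ‖b z - β θ‖ ^ 2 ≤ κ * m / 128 := by simpa [W] using hz
        have h4 : (∑ j, (R θ j).indicator (fun _ => (1 : ℝ)) z) * (κ / 4) ≤ m / 32 * (κ / 4) := by
          linarith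
        have := le_of_mul_le_mul_right h4 (by positivity)
        linarith
    have hi : ∀ s : Set (Fin n → L2 τ × ℝ), MeasurableSet s →
        Integrable (s.indicator fun _ => (1 : ℝ)) (D θ) := fun s hs =>
      (integrable_const 1).indicator hs
    have hv1 : ∀ s : Set (Fin n → L2 τ × ℝ), MeasurableSet s →
        ∫ z, s.indicator (fun _ => (1 : ℝ)) z ∂(D θ) = (D θ).real s := fun s hs =>
      integral_indicator_one hs
    have hint := integral_mono (μ := D θ) (integrable_finsetSum _ fun j _ => hi _ (hRm θ j))
      (((hi W hW).const_mul (m : ℝ)).add (integrable_const _)) hpt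
    rw [integral_finsetSum _ fun j _ => hi _ (hRm θ j)] at hint
    rw [integral_add' ((hi W hW).const_mul (m : ℝ)) (integrable_const _),
      integral_const_mul, hv1 W hW] at hint
    simp only [integral_const, probReal_univ, one_smul] at hint
    simp_rw [hv1 _ (hRm θ _)] at hint
    have : (D θ).real W < 1 / 32 := hcon θ
    nlinarith
  set flip : Fin m → (Fin m → Bool) → (Fin m → Bool) := fun j θ => Function.update θ j (!θ j)
  have hflip : ∀ j, Function.Involutive (flip j) := by
    intro j θ
    simp [flip]
  have hβflip : ∀ j θ, β (flip j θ) - β θ = (if θ j then -c j else c j) • u j := by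
    intro j θ
    simp only [hβ]
    rw [← Finset.sum_sub_distrib, Finset.sum_eq_single j]
    · rw [← sub_smul]
      cases h : θ j <;> simp [flip, h]
    · intro i _ hij
      simp [flip, Function.update_of_ne hij]
    · simp
  have hpair : ∀ j θ, 1 / 8 ≤ (D θ).real (R θ j) + (D (flip j θ)).real (R (flip j θ) j) := by
    intro j θ
    have hd : n * ∫ x, ⟪x, β (flip j θ) - β θ⟫ ^ 2 ∂F ≤ 4 * v := by
      rw [hβflip]
      convert hdist j using 4 with x
      cases θ j <;> simp [inner_smul_right]
    have hRR : R (flip j θ) j = (R θ j)ᶜ := by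
      cases h : θ j <;> simp [hR, flip, h]
    rw [hRR]
    exact dataLaw_two_point α₀ F hF hv (β θ) (β (flip j θ)) hd (hRm θ j)
  -- Flipping bit `j` permutes the hypercube, so summing `hpair` over `θ` counts each error
  -- probability twice. The average over `θ` of the expected number of errors is then at least
  -- `m/16`, against `hupper`.
  have hlower : ∀ j, Fintype.card (Fin m → Bool) * (1 / 16 : ℝ) ≤ ∑ θ, (D θ).real (R θ j) := by
    intro j
    have h1 : ∑ θ, (D (flip j θ)).real (R (flip j θ) j) = ∑ θ, (D θ).real (R θ j) :=
      Equiv.sum_comp (hflip j).toPerm fun θ => (D θ).real (R θ j)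
    have h2 : ∑ θ : Fin m → Bool, (1 / 8 : ℝ) ≤
        ∑ θ, ((D θ).real (R θ j) + (D (flip j θ)).real (R (flip j θ) j)) :=
      Finset.sum_le_sum fun θ _ => hpair j θ
    rw [Finset.sum_add_distrib, h1, Finset.sum_const, nsmul_eq_mul, Finset.card_univ] at h2
    linarith
  have h1 : ∑ θ, ∑ j, (D θ).real (R θ j) < ∑ θ : Fin m → Bool, (m / 16 : ℝ) :=
    Finset.sum_lt_sum_of_nonempty Finset.univ_nonempty fun θ _ => hupper θ
  have h2 := Finset.sum_le_sum fun j (_ : j ∈ (Finset.univ : Finset (Fin m))) => hlower j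
  rw [Finset.sum_comm] at h1
  simp only [Finset.sum_const, nsmul_eq_mul, Finset.card_univ, Fintype.card_fin] at h1 h2
  nlinarith

end DataLaw

/-! ### Deterministic oracle inequality -/

/-- A penalized least squares estimate obeys an oracle inequality as soon as the empirical second
moments of the features are close to the diagonal `v` in the weighted Hilbert–Schmidt norm. -/
theorem weighted_oracle_bound {n : ℕ} (φ : ℕ → Fin n → ℝ) (ε f : Fin n → ℝ) (v a d : ℕ → ℝ)
    {ζ b : ℝ} (hv : ∀ k, 0 ≤ v k) (ha : ∀ k, 0 ≤ a k) (hw : ∀ k, 0 < v k + a k)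
    (hsum : Summable fun k => (v k + a k) * d k ^ 2)
    (hf : ∀ i, Tendsto (fun N => ∑ k ∈ Finset.range N, d k * φ k i) atTop (𝓝 (f i)))
    (hH : ∀ N, ∑ q ∈ Finset.range N ×ˢ Finset.range N,
      ((1 / (n : ℝ)) * ∑ i, φ q.1 i * φ q.2 i - if q.1 = q.2 then v q.1 else 0) ^ 2
        / ((v q.1 + a q.1) * (v q.2 + a q.2)) ≤ 1 / 16)
    (hZ : ∀ N, ∑ k ∈ Finset.range N,
      ((1 / (n : ℝ)) * ∑ i, ε i * φ k i) ^ 2 / (v k + a k) ≤ ζ)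
    (hmin : (1 / (n : ℝ)) * ∑ i, f i ^ 2 + 1 / 2 * ∑' k, a k * d k ^ 2
      ≤ 2 * ((1 / (n : ℝ)) * ∑ i, ε i * f i) + b) :
    ∑' k, (v k + a k) * d k ^ 2 ≤ 64 * ζ + 8 * b := by
  set w : ℕ → ℝ := fun k => v k + a k with hwdef
  set W := ∑' k, w k * d k ^ 2 with hW
  have hsv : Summable fun k => v k * d k ^ 2 :=
    hsum.of_nonneg_of_le (fun k => mul_nonneg (hv k) (sq_nonneg _)) fun k =>
      mul_le_mul_of_nonneg_right (le_add_of_nonneg_right (ha k)) (sq_nonneg _)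
  have hsa : Summable fun k => a k * d k ^ 2 :=
    hsum.of_nonneg_of_le (fun k => mul_nonneg (ha k) (sq_nonneg _)) fun k =>
      mul_le_mul_of_nonneg_right (le_add_of_nonneg_left (hv k)) (sq_nonneg _)
  have hWsplit : W = ∑' k, v k * d k ^ 2 + ∑' k, a k * d k ^ 2 := by
    rw [hW, ← hsv.tsum_add hsa]
    exact tsum_congr fun k => by simp only [hwdef]; ring
  have hW0 : 0 ≤ W := tsum_nonneg fun k => mul_nonneg (hw k).le (sq_nonneg _)
  set WN : ℕ → ℝ := fun N => ∑ k ∈ Finset.range N, w k * d k ^ 2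
  have hWN : ∀ N, WN N ≤ W := fun N =>
    hsum.sum_le_tsum _ fun k _ => mul_nonneg (hw k).le (sq_nonneg _)
  have hWN0 : ∀ N, 0 ≤ WN N := fun N =>
    Finset.sum_nonneg fun k _ => mul_nonneg (hw k).le (sq_nonneg _)
  set fN : ℕ → Fin n → ℝ := fun N i => ∑ k ∈ Finset.range N, d k * φ k i
  -- The empirical and population quadratic forms differ by the pairing of `d ⊗ d` with the
  -- deviation matrix. Cauchy–Schwarz with weights `w ⊗ w` bounds it by `W` times the weighted
  -- Hilbert–Schmidt norm, at most `1/4`.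
  have hQ : ∀ N, ∑ k ∈ Finset.range N, v k * d k ^ 2 - W / 4
      ≤ (1 / (n : ℝ)) * ∑ i, fN N i ^ 2 := by
    intro N
    set m : ℕ × ℕ → ℝ := fun q =>
      (1 / (n : ℝ)) * ∑ i, φ q.1 i * φ q.2 i - if q.1 = q.2 then v q.1 else 0
    have hexp : (1 / (n : ℝ)) * ∑ i, fN N i ^ 2 - ∑ k ∈ Finset.range N, v k * d k ^ 2
        = ∑ q ∈ Finset.range N ×ˢ Finset.range N, d q.1 * d q.2 * m q := by
      have e1 : (1 / (n : ℝ)) * ∑ i, fN N i ^ 2 = ∑ q ∈ Finset.range N ×ˢ Finset.range N,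
          d q.1 * d q.2 * ((1 / (n : ℝ)) * ∑ i, φ q.1 i * φ q.2 i) := by
        have e0 : ∀ i, fN N i ^ 2 = ∑ q ∈ Finset.range N ×ˢ Finset.range N,
            (d q.1 * φ q.1 i) * (d q.2 * φ q.2 i) := by
          intro i
          rw [sq, Finset.sum_mul_sum, ← Finset.sum_product']
        simp_rw [e0, Finset.mul_sum]
        rw [Finset.sum_comm]
        exact Finset.sum_congr rfl fun q _ => Finset.sum_congr rfl fun i _ => by ring
      have e2 : ∑ k ∈ Finset.range N, v k * d k ^ 2 = ∑ q ∈ Finset.range N ×ˢ Finset.range N,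
          d q.1 * d q.2 * (if q.1 = q.2 then v q.1 else 0) := by
        rw [Finset.sum_product]
        refine Finset.sum_congr rfl fun k hk => ?_
        simp only [mul_ite, mul_zero, Finset.sum_ite_eq, hk, if_true]
        ring
      rw [e1, e2, ← Finset.sum_sub_distrib]
      exact Finset.sum_congr rfl fun q _ => by simp only [m]; ring
    have hcs : (∑ q ∈ Finset.range N ×ˢ Finset.range N, d q.1 * d q.2 * m q) ^ 2
        ≤ (W / 4) ^ 2 := by
      calc _ = (∑ q ∈ Finset.range N ×ˢ Finset.range N,
            (√(w q.1 * w q.2) * (d q.1 * d q.2)) * (m q / √(w q.1 * w q.2))) ^ 2 := by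
            congr 1
            refine Finset.sum_congr rfl fun q _ => ?_
            have : √(w q.1 * w q.2) ≠ 0 := (Real.sqrt_pos.2 (mul_pos (hw _) (hw _))).ne'
            field_simp
        _ ≤ (∑ q ∈ Finset.range N ×ˢ Finset.range N, (√(w q.1 * w q.2) * (d q.1 * d q.2)) ^ 2) *
            ∑ q ∈ Finset.range N ×ˢ Finset.range N, (m q / √(w q.1 * w q.2)) ^ 2 :=
            Finset.sum_mul_sq_le_sq_mul_sq _ _ _
        _ = WN N ^ 2 * ∑ q ∈ Finset.range N ×ˢ Finset.range N, m q ^ 2 / (w q.1 * w q.2) := by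
            congr 1
            · simp only [WN, sq (∑ k ∈ _, _), Finset.sum_mul_sum, ← Finset.sum_product']
              refine Finset.sum_congr rfl fun q _ => ?_
              rw [mul_pow, Real.sq_sqrt (mul_pos (hw _) (hw _)).le]; ring
            · refine Finset.sum_congr rfl fun q _ => ?_
              rw [div_pow, Real.sq_sqrt (mul_pos (hw _) (hw _)).le]
        _ ≤ W ^ 2 * (1 / 16) :=
            mul_le_mul (pow_le_pow_left₀ (hWN0 N) (hWN N) 2) (hH N)
              (Finset.sum_nonneg fun q _ => div_nonneg (sq_nonneg _) (mul_pos (hw _) (hw _)).le)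
              (sq_nonneg _)
        _ = (W / 4) ^ 2 := by ring
    have := abs_le_of_sq_le_sq' hcs (by positivity)
    linarith [this.1]
  have hE : ∀ N, ((1 / (n : ℝ)) * ∑ i, ε i * fN N i) ^ 2 ≤ ζ * W := by
    intro N
    have e1 : (1 / (n : ℝ)) * ∑ i, ε i * fN N i
        = ∑ k ∈ Finset.range N, d k * ((1 / (n : ℝ)) * ∑ i, ε i * φ k i) := by
      simp only [fN, Finset.mul_sum]
      rw [Finset.sum_comm]
      exact Finset.sum_congr rfl fun q _ => Finset.sum_congr rfl fun i _ => by ring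
    rw [e1]
    calc _ = (∑ k ∈ Finset.range N, (((1 / (n : ℝ)) * ∑ i, ε i * φ k i) / √(w k))
            * (√(w k) * d k)) ^ 2 := by
          congr 1
          refine Finset.sum_congr rfl fun k _ => ?_
          have : √(w k) ≠ 0 := (Real.sqrt_pos.2 (hw _)).ne'
          field_simp
      _ ≤ (∑ k ∈ Finset.range N, (((1 / (n : ℝ)) * ∑ i, ε i * φ k i) / √(w k)) ^ 2) *
          ∑ k ∈ Finset.range N, (√(w k) * d k) ^ 2 := Finset.sum_mul_sq_le_sq_mul_sq _ _ _
      _ = (∑ k ∈ Finset.range N, ((1 / (n : ℝ)) * ∑ i, ε i * φ k i) ^ 2 / w k) * WN N := by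
          congr 1 <;> refine Finset.sum_congr rfl fun k _ => ?_
          · rw [div_pow, Real.sq_sqrt (hw k).le]
          · rw [mul_pow, Real.sq_sqrt (hw k).le]
      _ ≤ ζ * W := mul_le_mul (hZ N) (hWN N) (hWN0 N)
          ((Finset.sum_nonneg fun k _ => div_nonneg (sq_nonneg _) (hw k).le).trans (hZ N))
  have hQlim : ∑' k, v k * d k ^ 2 - W / 4 ≤ (1 / (n : ℝ)) * ∑ i, f i ^ 2 :=
    le_of_tendsto_of_tendsto' (hsv.hasSum.tendsto_sum_nat.sub_const _)
      ((tendsto_finsetSum _ fun i _ => (hf i).pow 2).const_mul _) hQ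
  have hElim : ((1 / (n : ℝ)) * ∑ i, ε i * f i) ^ 2 ≤ ζ * W :=
    le_of_tendsto' (((tendsto_finsetSum _ fun i _ => (hf i).const_mul (ε i)).const_mul _).pow 2) hE
  have hζ : 0 ≤ ζ := by simpa using hZ 0
  have hva : 0 ≤ ∑' k, v k * d k ^ 2 := tsum_nonneg fun k => mul_nonneg (hv k) (sq_nonneg _)
  -- Arithmetic–geometric mean on `ζ W`. The basic inequality then leaves `W/2 - W/4 - W/8 ≤ 8 ζ +
  -- b`.
  have hE2 : 2 * ((1 / (n : ℝ)) * ∑ i, ε i * f i) ≤ W / 8 + 8 * ζ := by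
    refine le_of_sq_le_sq ?_ (by positivity)
    nlinarith [sq_nonneg (W / 8 - 8 * ζ)]
  linarith

/-! ### Concentration of empirical moments by second moments -/

section Moments

variable {Z : Type*} [MeasurableSpace Z]

theorem lintegral_sq_mean_le {n : ℕ} (hn : 0 < n) (P : Measure Z) [IsProbabilityMeasure P]
    {h : Z → ℝ} (hh : MemLp h 2 P) (h0 : ∫ z, h z ∂P = 0) :
    ∫⁻ z, ENNReal.ofReal (((1 / (n : ℝ)) * ∑ i, h (z i)) ^ 2) ∂(Measure.pi fun _ : Fin n => P)
      ≤ ENNReal.ofReal ((∫ z, h z ^ 2 ∂P) / n) := by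
  set PP := Measure.pi fun _ : Fin n => P
  have hi : ∀ i : Fin n, MemLp (fun z : Fin n → Z => h (z i)) 2 PP := fun i =>
    hh.comp_measurePreserving (measurePreserving_eval _ i)
  have hs : MemLp (fun z : Fin n → Z => ∑ i, h (z i)) 2 PP := memLp_finsetSum _ fun i _ => hi i
  have hmean : ∀ i : Fin n, ∫ z, h (z i) ∂PP = 0 := by
    intro i
    rw [← h0, ← (measurePreserving_eval (fun _ : Fin n => P) i).map_eq, integral_map
      (measurable_pi_apply i).aemeasurable]
    rw [(measurePreserving_eval (fun _ : Fin n => P) i).map_eq]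
    exact hh.1
  have hvar := variance_sum_pi (μ := fun _ : Fin n => P) (X := fun _ => h) fun _ => hh
  have hsm : ∫ z, ∑ i, h (z i) ∂PP = 0 := by
    rw [integral_finsetSum _ fun i _ => (hi i).integrable one_le_two]
    simp [hmean]
  have e : (∑ i : Fin n, fun ω : Fin n → Z => h (ω i)) = fun ω => ∑ i, h (ω i) := by
    ext ω; simp
  rw [e, variance_of_integral_eq_zero hs.1.aemeasurable hsm,
    variance_of_integral_eq_zero hh.1.aemeasurable h0] at hvar
  have hI : Integrable (fun z : Fin n → Z => ((1 / (n : ℝ)) * ∑ i, h (z i)) ^ 2) PP :=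
    (hs.const_mul (1 / (n : ℝ))).integrable_sq
  rw [← ofReal_integral_eq_lintegral_ofReal hI (ae_of_all _ fun z => sq_nonneg _)]
  apply ENNReal.ofReal_le_ofReal
  simp_rw [mul_pow]
  rw [integral_const_mul, hvar]
  have : (n : ℝ) ≠ 0 := by exact_mod_cast hn.ne'
  simp only [Finset.sum_const, Finset.card_univ, Fintype.card_fin, nsmul_eq_mul]
  apply le_of_eq
  field_simp

theorem tsum_ofReal_le {ι : Type*} {f : ι → ℝ} (hf : ∀ i, 0 ≤ f i) {c : ℝ}
    (h : ∑' i, ENNReal.ofReal (f i) ≤ ENNReal.ofReal c) (hc : 0 ≤ c) (s : Finset ι) :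
    ∑ i ∈ s, f i ≤ c := by
  rw [← ENNReal.ofReal_le_ofReal_iff hc, ENNReal.ofReal_sum_of_nonneg fun i _ => hf i]
  exact (ENNReal.sum_le_tsum s).trans h

/-- The empirical second moments of the features and their empirical correlations with the noise
are small with large probability. -/
theorem empirical_moments_bound {n : ℕ} (hn : 0 < n) (P : Measure Z) [IsProbabilityMeasure P]
    (φ : ℕ → Z → ℝ) (ε : Z → ℝ) (v w : ℕ → ℝ) {M M₂ ζ : ℝ} (hM : 0 ≤ M) (hM₂ : 0 ≤ M₂)
    (hζ : 0 < ζ) (hv : ∀ k, 0 ≤ v k) (hw : ∀ k, 0 < w k) (hs : Summable fun k => v k / w k)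
    (hφm : ∀ k, Measurable (φ k)) (hεm : Measurable ε)
    (hφ : ∀ j k, MemLp (fun z => φ j z * φ k z) 2 P)
    (hφv : ∀ j k, ∫ z, φ j z * φ k z ∂P = if j = k then v j else 0)
    (hφ4 : ∀ j k, ∫ z, (φ j z * φ k z) ^ 2 ∂P ≤ M * (v j * v k))
    (hε : ∀ k, MemLp (fun z => ε z * φ k z) 2 P)
    (hε0 : ∀ k, ∫ z, ε z * φ k z ∂P = 0)
    (hε2 : ∀ k, ∫ z, (ε z * φ k z) ^ 2 ∂P ≤ M₂ * v k) :
    (Measure.pi fun _ : Fin n => P) {z | ¬ ((∀ N, ∑ q ∈ Finset.range N ×ˢ Finset.range N,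
      ((1 / (n : ℝ)) * ∑ i, φ q.1 (z i) * φ q.2 (z i) - if q.1 = q.2 then v q.1 else 0) ^ 2
        / (w q.1 * w q.2) ≤ 1 / 16) ∧
      ∀ N, ∑ k ∈ Finset.range N, ((1 / (n : ℝ)) * ∑ i, ε (z i) * φ k (z i)) ^ 2 / w k ≤ ζ)}
    ≤ ENNReal.ofReal (16 * (M * (∑' k, v k / w k) ^ 2 / n)) +
      ENNReal.ofReal (M₂ * (∑' k, v k / w k) / n / ζ) := by
  set PP := Measure.pi fun _ : Fin n => P
  have hn' : (n : ℝ) ≠ 0 := by exact_mod_cast hn.ne'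
  set A : ℕ × ℕ → (Fin n → Z) → ℝ := fun q z =>
    ((1 / (n : ℝ)) * ∑ i, φ q.1 (z i) * φ q.2 (z i) - if q.1 = q.2 then v q.1 else 0) ^ 2
        / (w q.1 * w q.2) with hA
  set Q : ℕ → (Fin n → Z) → ℝ := fun k z =>
    ((1 / (n : ℝ)) * ∑ i, ε (z i) * φ k (z i)) ^ 2 / w k with hQ
  have hA0 : ∀ q z, 0 ≤ A q z := fun q z => div_nonneg (sq_nonneg _) (mul_pos (hw _) (hw _)).le
  have hQ0 : ∀ q z, 0 ≤ Q q z := fun q z => div_nonneg (sq_nonneg _) (hw _).le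
  have hAm : ∀ q, Measurable (A q) := fun q => by fun_prop
  have hQm : ∀ q, Measurable (Q q) := fun q => by fun_prop
  set S := ∑' k, v k / w k with hS
  have hS0 : 0 ≤ S := tsum_nonneg fun k => div_nonneg (hv k) (hw k).le
  have hAint : ∀ q, ∫⁻ z, ENNReal.ofReal (A q z) ∂PP
      ≤ ENNReal.ofReal (M / n * (v q.1 / w q.1 * (v q.2 / w q.2))) := by
    intro q
    set h : Z → ℝ := fun z => φ q.1 z * φ q.2 z - if q.1 = q.2 then v q.1 else 0 with hh
    have hhL : MemLp h 2 P := (hφ q.1 q.2).sub (memLp_const _)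
    have hh0 : ∫ z, h z ∂P = 0 := by
      simp only [hh]
      rw [integral_sub ((hφ _ _).integrable one_le_two) (integrable_const _), hφv]
      simp
    have hh2 : ∫ z, h z ^ 2 ∂P ≤ M * (v q.1 * v q.2) := by
      refine le_trans ?_ (hφ4 q.1 q.2)
      have e : h = fun z => φ q.1 z * φ q.2 z - ∫ z, φ q.1 z * φ q.2 z ∂P := by
        simp only [hh, hφv]
      rw [e, ← variance_eq_integral (hφ q.1 q.2).1.aemeasurable]
      exact variance_le_expectation_sq (hφ q.1 q.2).1
    have e : ∀ z, ENNReal.ofReal (A q z) = ENNReal.ofReal (1 / (w q.1 * w q.2)) *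
        ENNReal.ofReal (((1 / (n : ℝ)) * ∑ i, h (z i)) ^ 2) := by
      intro z
      rw [← ENNReal.ofReal_mul (one_div_pos.2 (mul_pos (hw _) (hw _))).le]
      congr 1
      simp only [hA, hh, Finset.sum_sub_distrib, Finset.sum_const, Finset.card_univ,
        Fintype.card_fin, nsmul_eq_mul, mul_sub]
      rw [← mul_assoc (1 / (n : ℝ)) (n : ℝ), one_div_mul_cancel hn', one_mul]
      ring
    simp_rw [e]
    rw [lintegral_const_mul' _ _ ENNReal.ofReal_ne_top]
    refine (mul_le_mul_right (lintegral_sq_mean_le hn P hhL hh0) _).trans ?_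
    rw [← ENNReal.ofReal_mul (one_div_pos.2 (mul_pos (hw _) (hw _))).le]
    apply ENNReal.ofReal_le_ofReal
    have hw1 := hw q.1
    have hw2 := hw q.2
    calc 1 / (w q.1 * w q.2) * ((∫ z, h z ^ 2 ∂P) / n)
        ≤ 1 / (w q.1 * w q.2) * (M * (v q.1 * v q.2) / n) := by gcongr
      _ = _ := by field_simp
  have hQint : ∀ k, ∫⁻ z, ENNReal.ofReal (Q k z) ∂PP
      ≤ ENNReal.ofReal (M₂ / n * (v k / w k)) := by
    intro k
    have e : ∀ z, ENNReal.ofReal (Q k z) = ENNReal.ofReal (1 / w k) *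
        ENNReal.ofReal (((1 / (n : ℝ)) * ∑ i, ε (z i) * φ k (z i)) ^ 2) := by
      intro z
      rw [← ENNReal.ofReal_mul (one_div_pos.2 (hw _)).le]
      congr 1
      simp only [hQ]
      ring
    simp_rw [e]
    rw [lintegral_const_mul' _ _ ENNReal.ofReal_ne_top]
    refine (mul_le_mul_right (lintegral_sq_mean_le hn P (hε k) (hε0 k)) _).trans ?_
    rw [← ENNReal.ofReal_mul (one_div_pos.2 (hw _)).le]
    apply ENNReal.ofReal_le_ofReal
    have hw1 := hw k
    have := hε2 k
    calc 1 / w k * ((∫ z, (ε z * φ k z) ^ 2 ∂P) / n)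
        ≤ 1 / w k * (M₂ * v k / n) := by gcongr
      _ = _ := by field_simp
  have hratio : ∀ k, 0 ≤ v k / w k := fun k => div_nonneg (hv k) (hw k).le
  have hAsum : ∫⁻ z, ∑' q, ENNReal.ofReal (A q z) ∂PP ≤ ENNReal.ofReal (M * S ^ 2 / n) := by
    rw [lintegral_tsum fun q => (hAm q).ennreal_ofReal.aemeasurable]
    refine (ENNReal.tsum_le_tsum hAint).trans ?_
    have hss : Summable fun q : ℕ × ℕ => v q.1 / w q.1 * (v q.2 / w q.2) :=
      hs.mul_of_nonneg hs hratio hratio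
    rw [← ENNReal.ofReal_tsum_of_nonneg (fun q => mul_nonneg (by positivity)
      (mul_nonneg (hratio _) (hratio _))) (hss.mul_left _), tsum_mul_left,
      ← hs.tsum_mul_tsum hs hss, ← hS]
    apply le_of_eq; congr 1; ring
  have hQsum : ∫⁻ z, ∑' q, ENNReal.ofReal (Q q z) ∂PP ≤ ENNReal.ofReal (M₂ * S / n) := by
    rw [lintegral_tsum fun q => (hQm q).ennreal_ofReal.aemeasurable]
    refine (ENNReal.tsum_le_tsum hQint).trans ?_
    rw [← ENNReal.ofReal_tsum_of_nonneg (fun q => mul_nonneg (by positivity) (hratio _))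
      (hs.mul_left _), tsum_mul_left, ← hS]
    apply le_of_eq; congr 1; ring
  -- All truncation levels `N` are controlled at once by the full infinite sums, so Markov's
  -- inequality is used only twice and no union over `N` is needed.
  have hsub : {z | ¬ ((∀ N, ∑ q ∈ Finset.range N ×ˢ Finset.range N, A q z ≤ 1 / 16) ∧
      ∀ N, ∑ k ∈ Finset.range N, Q k z ≤ ζ)} ⊆
      {z | ENNReal.ofReal (1 / 16) ≤ ∑' q, ENNReal.ofReal (A q z)} ∪
      {z | ENNReal.ofReal ζ ≤ ∑' q, ENNReal.ofReal (Q q z)} := by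
    intro z hz
    by_contra hc
    simp only [Set.mem_union, Set.mem_ofPred_eq, not_or, not_le] at hc
    exact hz ⟨fun N => tsum_ofReal_le (fun q => hA0 q z) hc.1.le (by norm_num) _,
      fun N => tsum_ofReal_le (fun q => hQ0 q z) hc.2.le hζ.le _⟩
  refine (measure_mono hsub).trans ((measure_union_le _ _).trans (add_le_add ?_ ?_))
  · refine (meas_ge_le_lintegral_div (Measurable.tsum
      fun q => (hAm q).ennreal_ofReal).aemeasurable (by simp) ENNReal.ofReal_ne_top).trans ?_
    refine (ENNReal.div_le_div_right hAsum _).trans ?_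
    rw [← ENNReal.ofReal_div_of_pos (by norm_num)]
    apply ENNReal.ofReal_le_ofReal
    linarith
  · refine (meas_ge_le_lintegral_div (Measurable.tsum
      fun q => (hQm q).ennreal_ofReal).aemeasurable (by simpa using hζ)
        ENNReal.ofReal_ne_top).trans ?_
    refine (ENNReal.div_le_div_right hQsum _).trans ?_
    rw [← ENNReal.ofReal_div_of_pos hζ]

end Moments

/-! ### Eigensystems, and the factorization `ι ι*` -/

section Spectral

variable {E : Type*} [NormedAddCommGroup E] [InnerProductSpace ℝ E] [CompleteSpace E]

theorem summable_inner_smul {u : ℕ → E} (hu : Orthonormal ℝ u) (f : E) :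
    Summable fun k => ⟪u k, f⟫ • u k := by
  have h := (hu.orthogonalFamily.summable_iff_norm_sq_summable fun k => ⟪u k, f⟫).2
    (hu.inner_products_summable (x := f))
  simpa using h

theorem inner_sub_tsum_eq_zero {u : ℕ → E} (hu : Orthonormal ℝ u) (f : E) (k : ℕ) :
    ⟪u k, f - ∑' j, ⟪u j, f⟫ • u j⟫ = 0 := by
  have h : HasSum (fun j => ⟪u k, ⟪u j, f⟫ • u j⟫) ⟪u k, ∑' j, ⟪u j, f⟫ • u j⟫ :=
    (summable_inner_smul hu f).hasSum.mapL (innerSL ℝ (u k))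
  have h2 : HasSum (fun j => ⟪u k, ⟪u j, f⟫ • u j⟫) ⟪u k, f⟫ := by
    convert hasSum_ite_eq k ⟪u k, f⟫ using 1
    funext j
    rw [inner_smul_right, orthonormal_iff_ite.1 hu k j]
    split_ifs with h1 h2 h2
    · rw [h1, mul_one]
    · exact absurd h1.symm h2
    · exact absurd h2.symm h1
    · rw [mul_zero]
  rw [inner_sub_right, h.unique h2, sub_self]

namespace IsEigenSystem

variable {A : E →L[ℝ] E} {e : ℕ → ℝ} {u : ℕ → E}

theorem hasSum_apply (h : IsEigenSystem A e u) (f : E) :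
    HasSum (fun k => (e k * ⟪u k, f⟫) • u k) (A f) := by
  have h0 : A (f - ∑' j, ⟪u j, f⟫ • u j) = 0 :=
    h.complete _ fun k => inner_sub_tsum_eq_zero h.orthonormal f k
  have hA : A f = A (∑' j, ⟪u j, f⟫ • u j) := by rwa [map_sub, sub_eq_zero] at h0
  rw [hA]
  convert (summable_inner_smul h.orthonormal f).hasSum.mapL A using 2 with k
  rw [map_smul, h.apply_eq, smul_smul, mul_comm]

theorem hasSum_inner (h : IsEigenSystem A e u) (f g : E) :
    HasSum (fun k => e k * ⟪u k, f⟫ * ⟪u k, g⟫) ⟪A f, g⟫ := by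
  have := (h.hasSum_apply f).mapL (innerSL ℝ g)
  simp only [innerSL_apply_apply, inner_smul_right] at this
  simp_rw [show ∀ k, ⟪g, u k⟫ = ⟪u k, g⟫ from fun k => real_inner_comm _ _] at this
  rwa [real_inner_comm g (A f)]

/-- One half of the uniqueness of the ordered eigenvalues, by a min-max argument. -/
theorem eigenvalue_le {e' : ℕ → ℝ} {u' : ℕ → E} (h : IsEigenSystem A e u)
    (h' : IsEigenSystem A e' u') (he' : ∀ k, 0 ≤ e' k) (k : ℕ) : e k ≤ e' k := by
  let Φ : (Fin (k + 1) → ℝ) →ₗ[ℝ] (Fin k → ℝ) :=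
    LinearMap.pi fun j => ∑ i : Fin (k + 1), ⟪u' j, u i⟫ • LinearMap.proj i
  -- There are `k + 1` unknowns and `k` equations: some nonzero `f` in the span of `u₀, …, uₖ` is
  -- orthogonal to `u'₀, …, u'ₖ₋₁`. Its Rayleigh quotient is at least `e k` and at most `e' k`.
  have hker : LinearMap.ker Φ ≠ ⊥ := LinearMap.ker_ne_bot_of_finrank_lt (by simp)
  obtain ⟨c, hc, hc0⟩ := Submodule.exists_mem_ne_zero_of_ne_bot hker
  set f : E := ∑ i : Fin (k + 1), c i • u i with hf
  have hu : Orthonormal ℝ fun i : Fin (k + 1) => u i :=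
    h.orthonormal.comp _ Fin.val_injective
  have horth : ∀ j < k, ⟪u' j, f⟫ = 0 := by
    intro j hj
    have := congrFun (LinearMap.mem_ker.1 hc) ⟨j, hj⟩
    simp only [Φ, LinearMap.pi_apply, LinearMap.sum_apply, LinearMap.smul_apply,
      LinearMap.proj_apply, smul_eq_mul, Pi.zero_apply] at this
    rw [hf, inner_sum, ← this]
    exact Finset.sum_congr rfl fun i _ => by rw [inner_smul_right, mul_comm]
  have hnorm : ‖f‖ ^ 2 = ∑ i, c i ^ 2 := by
    rw [← real_inner_self_eq_norm_sq, hf, hu.inner_sum]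
    simp [sq]
  have hpos : 0 < ‖f‖ ^ 2 := by
    rw [hnorm]
    obtain ⟨i, hi⟩ := Function.ne_iff.1 hc0
    exact Finset.sum_pos' (fun i _ => sq_nonneg _) ⟨i, Finset.mem_univ _, by
      have : c i ≠ 0 := hi
      positivity⟩
  have hlow : e k * ‖f‖ ^ 2 ≤ ⟪A f, f⟫ := by
    have hAf : A f = ∑ i : Fin (k + 1), (c i * e i) • u i := by
      rw [hf, map_sum]
      exact Finset.sum_congr rfl fun i _ => by rw [map_smul, h.apply_eq, smul_smul]
    have hin : ⟪A f, f⟫ = ∑ i : Fin (k + 1), c i * e i * c i := by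
      rw [hAf, hf, hu.inner_sum]
      simp
    rw [hin, hnorm, Finset.mul_sum]
    refine Finset.sum_le_sum fun i _ => ?_
    have := h.antitone (Nat.lt_succ_iff.1 i.2)
    nlinarith [mul_le_mul_of_nonneg_right this (sq_nonneg (c i))]
  have hup : ⟪A f, f⟫ ≤ e' k * ‖f‖ ^ 2 := by
    have hs := h'.orthonormal.inner_products_summable (x := f)
    have hb := h'.orthonormal.tsum_inner_products_le (x := f)
    refine le_trans ?_ (mul_le_mul_of_nonneg_left hb (he' k))
    rw [← tsum_mul_left]
    refine (h'.hasSum_inner f f).tsum_eq ▸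
      (h'.hasSum_inner f f).summable.tsum_le_tsum (fun j => ?_) (hs.mul_left _)
    rw [Real.norm_eq_abs, sq_abs]
    rcases lt_or_ge j k with hj | hj
    · simp [horth j hj]
    · rw [mul_assoc, ← sq]
      exact mul_le_mul_of_nonneg_right (h'.antitone hj) (sq_nonneg _)
  exact le_of_mul_le_mul_right (hlow.trans hup) hpos

end IsEigenSystem

section Factor

variable {H : Type*} [NormedAddCommGroup H] [InnerProductSpace ℝ H] [CompleteSpace H]
  {ι : H →L[ℝ] E} {ρ : ℕ → ℝ} {ψ : ℕ → E}

/-- The `ψ k` need not span `L2`, but they suffice on the range of `ι`: the part `g` of `ι x`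
orthogonal to all of them is killed by `ι ι*`, hence by `ι*`, so it is orthogonal to `ι x` and
vanishes. -/
theorem hasSum_of_range (h : IsEigenSystem (ι ∘L ι.adjoint) ρ ψ) (x : H) :
    HasSum (fun k => ⟪ψ k, ι x⟫ • ψ k) (ι x) := by
  set g := ι x - ∑' j, ⟪ψ j, ι x⟫ • ψ j with hg
  have hperp : ∀ k, ⟪ψ k, g⟫ = 0 := inner_sub_tsum_eq_zero h.orthonormal (ι x)
  have hK : ι (ι.adjoint g) = 0 := h.complete g hperp
  have h1 : ι.adjoint g = 0 := by
    rw [← inner_self_eq_zero (𝕜 := ℝ), ContinuousLinearMap.adjoint_inner_left, hK, inner_zero_right]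
  have h2 : ⟪g, ι x⟫ = 0 := by
    rw [← ContinuousLinearMap.adjoint_inner_left, h1, inner_zero_left]
  have h3 : ⟪g, ∑' j, ⟪ψ j, ι x⟫ • ψ j⟫ = 0 := by
    have := (summable_inner_smul h.orthonormal (ι x)).hasSum.mapL (innerSL ℝ g)
    simp only [innerSL_apply_apply, inner_smul_right] at this
    rw [← this.tsum_eq]
    simp [real_inner_comm, hperp]
  have h4 : g = 0 := by
    rw [← inner_self_eq_zero (𝕜 := ℝ)]
    nth_rewrite 2 [hg]
    rw [inner_sub_right, h2, h3, sub_zero]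
  have := (summable_inner_smul h.orthonormal (ι x)).hasSum
  rwa [← sub_eq_zero.1 h4] at this

theorem hasSum_norm_sq_of_range (h : IsEigenSystem (ι ∘L ι.adjoint) ρ ψ) (x : H) :
    HasSum (fun k => ⟪ψ k, ι x⟫ ^ 2) (‖ι x‖ ^ 2) := by
  have := (hasSum_of_range h x).mapL (innerSL ℝ (ι x))
  simp only [innerSL_apply_apply, inner_smul_right, real_inner_self_eq_norm_sq] at this
  simp_rw [show ∀ k, ⟪ι x, ψ k⟫ = ⟪ψ k, ι x⟫ from fun k => real_inner_comm _ _, ← sq] at this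
  exact this

theorem inner_adjoint_eigenvector (h : IsEigenSystem (ι ∘L ι.adjoint) ρ ψ) (j k : ℕ) :
    ⟪ι.adjoint (ψ j), ι.adjoint (ψ k)⟫ = if j = k then ρ k else 0 := by
  have : ι (ι.adjoint (ψ k)) = ρ k • ψ k := h.apply_eq k
  rw [ContinuousLinearMap.adjoint_inner_left, this, inner_smul_right,
    orthonormal_iff_ite.1 h.orthonormal]
  split_ifs <;> simp

theorem orthonormal_adjoint_eigenvector (h : IsEigenSystem (ι ∘L ι.adjoint) ρ ψ)
    (hρ : ∀ k, 0 < ρ k) : Orthonormal ℝ fun k => (√(ρ k))⁻¹ • ι.adjoint (ψ k) := by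
  rw [orthonormal_iff_ite]
  intro j k
  rw [inner_smul_left, inner_smul_right, inner_adjoint_eigenvector h]
  split_ifs with hjk
  · subst hjk
    have := Real.mul_self_sqrt (hρ j).le
    have h0 : √(ρ j) ≠ 0 := (Real.sqrt_pos.2 (hρ j)).ne'
    simp only [conj_trivial]
    field_simp
    linarith
  · simp

/-- Bessel's inequality in `H` for the orthonormal vectors `ρₖ^{-1/2} ι* ψₖ`. It compares the
penalty with the spectral coordinates; equality is not needed for the upper bound. -/
theorem penalty_bessel (h : IsEigenSystem (ι ∘L ι.adjoint) ρ ψ) (hρ : ∀ k, 0 < ρ k) (x : H) :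
    (Summable fun k => ⟪ψ k, ι x⟫ ^ 2 / ρ k) ∧ ∑' k, ⟪ψ k, ι x⟫ ^ 2 / ρ k ≤ ‖x‖ ^ 2 := by
  have ho := orthonormal_adjoint_eigenvector h hρ
  have e : ∀ k, ‖⟪(√(ρ k))⁻¹ • ι.adjoint (ψ k), x⟫‖ ^ 2 = ⟪ψ k, ι x⟫ ^ 2 / ρ k := by
    intro k
    rw [inner_smul_left, ContinuousLinearMap.adjoint_inner_left, Real.norm_eq_abs, sq_abs,
      mul_pow, conj_trivial, inv_pow, Real.sq_sqrt (hρ k).le]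
    ring
  have h1 := ho.inner_products_summable (x := x)
  have h2 := ho.tsum_inner_products_le (x := x)
  simp_rw [e] at h1 h2
  exact ⟨h1, h2⟩

/-- A finite combination of eigenfunctions has a preimage of the expected norm. -/
theorem exists_preimage (h : IsEigenSystem (ι ∘L ι.adjoint) ρ ψ) (hρ : ∀ k, 0 < ρ k)
    {m : ℕ} {κ : Fin m → ℕ} (hκ : Function.Injective κ) (c : Fin m → ℝ) :
    ∃ x : H, ι x = ∑ j, c j • ψ (κ j) ∧ ‖x‖ ^ 2 = ∑ j, c j ^ 2 / ρ (κ j) := by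
  have ho := (orthonormal_adjoint_eigenvector h hρ).comp κ hκ
  refine ⟨∑ j, (c j / √(ρ (κ j))) • (√(ρ (κ j)))⁻¹ • ι.adjoint (ψ (κ j)), ?_, ?_⟩
  · rw [map_sum]
    refine Finset.sum_congr rfl fun j _ => ?_
    have : ι (ι.adjoint (ψ (κ j))) = ρ (κ j) • ψ (κ j) := h.apply_eq _
    rw [map_smul, map_smul, this, smul_smul, smul_smul]
    congr 1
    have h1 := Real.sq_sqrt (hρ (κ j)).le
    have h0 : √(ρ (κ j)) ≠ 0 := (Real.sqrt_pos.2 (hρ _)).ne'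
    field_simp
    rw [h1]
  · rw [← real_inner_self_eq_norm_sq]
    have := ho.inner_sum (fun j => c j / √(ρ (κ j))) (fun j => c j / √(ρ (κ j))) Finset.univ
    simp only [Function.comp_apply] at this
    rw [this]
    refine Finset.sum_congr rfl fun j _ => ?_
    rw [conj_trivial, ← sq, div_pow, Real.sq_sqrt (hρ _).le]

end Factor

end Spectral

/-! ### Triviality of the null space and the embedding into `L2` -/

section Reduction

variable {T : Type*} [MeasurableSpace T] {τ : Measure T}
  {H : Type*} [NormedAddCommGroup H] [InnerProductSpace ℝ H] [RKHS ℝ H T ℝ]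

theorem toL2_add (hH : ∀ f : H, MemLp (f : T → ℝ) 2 τ) (f g : H) :
    toL2 hH (f + g) = toL2 hH f + toL2 hH g := by
  unfold toL2
  rw [← MemLp.toLp_add (hH f) (hH g)]
  exact MemLp.toLp_congr _ _ (ae_of_all _ fun t => by simp)

theorem toL2_smul (hH : ∀ f : H, MemLp (f : T → ℝ) 2 τ) (a : ℝ) (f : H) :
    toL2 hH (a • f) = a • toL2 hH f := by
  unfold toL2
  rw [← MemLp.toLp_const_smul a (hH f)]
  exact MemLp.toLp_congr _ _ (ae_of_all _ fun t => by simp)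

theorem toL2_sub (hH : ∀ f : H, MemLp (f : T → ℝ) 2 τ) (f g : H) :
    toL2 hH (f - g) = toL2 hH f - toL2 hH g := by
  have := toL2_add hH (f - g) g
  rw [sub_add_cancel] at this
  rw [this, add_sub_cancel_right]

theorem inner_covOp (F : Measure (L2 τ)) (f g : L2 τ) :
    ⟪covOp F f, g⟫ = covarianceBilin F f g := by
  unfold covOp
  rw [InnerProductSpace.continuousLinearMapOfBilin_apply]

/-- An isotropic vector of a positive semidefinite form lies in its kernel: otherwise moving from
`f` along `C f` would make the form negative. -/
theorem covOp_eq_zero_of_inner_self (F : Measure (L2 τ)) {f : L2 τ} (h : ⟪covOp F f, f⟫ = 0) :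
    covOp F f = 0 := by
  rw [inner_covOp] at h
  rw [← inner_self_eq_zero (𝕜 := ℝ)]
  set g := covOp F f
  have hg : ⟪g, g⟫ = covarianceBilin F f g := inner_covOp F f g
  rw [hg]
  have key : ∀ t : ℝ, 0 ≤ 2 * t * covarianceBilin F f g + t ^ 2 * covarianceBilin F g g := by
    intro t
    have := covarianceBilin_self_nonneg (μ := F) (f + t • g)
    simp only [map_add, map_smul, add_apply, smul_apply,
      smul_eq_mul, h, covarianceBilin_comm (μ := F) g f] at this
    linarith
  by_contra hne
  set x := covarianceBilin F f g
  set y := covarianceBilin F g g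
  have hy : 0 ≤ y := covarianceBilin_self_nonneg g
  -- The denominator is `y + 1` instead of `y`, which may be zero.
  have := key (-x / (y + 1))
  have e : 2 * (-x / (y + 1)) * x + (-x / (y + 1)) ^ 2 * y = -(x ^ 2 * (y + 2)) / (y + 1) ^ 2 := by
    field_simp
    ring
  rw [e] at this
  have hx : 0 < x ^ 2 := by positivity
  have : -(x ^ 2 * (y + 2)) / (y + 1) ^ 2 < 0 := by
    apply div_neg_of_neg_of_pos
    · nlinarith
    · positivity
  linarith

/-- If all the `γₖ` are finite, then the null space of the penalty is trivial: the elements of the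
null space are eigenvectors for the eigenvalue `1`. -/
theorem nullSpace_eq_bot {hH : ∀ f : H, MemLp (f : T → ℝ) 2 τ} {H₀ : Submodule ℝ H}
    [H₀.HasOrthogonalProjection] {F : Measure (L2 τ)} {γ : ℕ → ℝ}
    (hnd : ∀ f ∈ H₀, f ≠ 0 → covOp F (toL2 hH f) ≠ 0) (hγ : IsSimDiag hH H₀ (covOp F) γ) :
    H₀ = ⊥ := by
  obtain ⟨hγ0, R, S, hR, hS, hSR, ζ, hζ⟩ := hγ
  rw [Submodule.eq_bot_iff]
  intro f hf
  by_contra hf0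
  set C := covOp F
  have hC := hnd f hf hf0
  have hpenf : pen H₀ f = 0 := by
    simp [pen, Submodule.starProjection_eq_self_iff.2 hf]
  -- Since `f` has no penalty, `⟨C f, g⟩ = ⟨f, g⟩_R`, so the representer `h` of `C f` should be `f`
  -- itself. Testing with `h - f` shows that this difference has zero `R`-norm, and nondegeneracy on
  -- `H₀` makes it zero.
  obtain ⟨h, hh, hin⟩ := hR (C (toL2 hH f))
  have hpen_sub : pen H₀ (h - f) = pen H₀ h - pen H₀ f := by
    simp only [pen, map_sub]; abel
  have h0 : innerR hH H₀ C (h - f) (h - f) = 0 := by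
    have h1 := hin (h - f)
    unfold innerR at h1 ⊢
    rw [toL2_sub, map_sub, inner_sub_left, hpen_sub, hpenf, sub_zero]
    rw [toL2_sub, hpen_sub, hpenf, sub_zero] at h1
    linarith
  unfold innerR at h0
  have hCnn : 0 ≤ ⟪C (toL2 hH (h - f)), toL2 hH (h - f)⟫ := by
    rw [inner_covOp]; exact covarianceBilin_self_nonneg _
  have hpnn : 0 ≤ ⟪pen H₀ (h - f), pen H₀ (h - f)⟫ := real_inner_self_nonneg
  have hp0 : pen H₀ (h - f) = 0 := by
    rw [← inner_self_eq_zero (𝕜 := ℝ)]; linarith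
  have hmem : h - f ∈ H₀ := by
    rw [← Submodule.starProjection_eq_self_iff]
    exact (sub_eq_zero.1 hp0).symm
  have hC0 : C (toL2 hH (h - f)) = 0 := covOp_eq_zero_of_inner_self F (by linarith)
  have hhf : h = f := by
    by_contra hne
    exact hnd _ hmem (sub_ne_zero.2 hne) hC0
  have hRC : S (S (C (toL2 hH f))) = toL2 hH f := by
    rw [hhf, ← hSR] at hh
    exact hh.symm
  -- From `S S C f = f`, the vector `x = S C f` is fixed by `S C S`. Its coordinates along the `ζ k`
  -- vanish since their eigenvalues are below `1`, so completeness gives `S C S x = 0`.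
  set x := S (C (toL2 hH f)) with hx
  have hfix : (S ∘L C ∘L S) x = x := by
    simp only [ContinuousLinearMap.comp_apply]
    rw [hRC]
  have hx0 : x ≠ 0 := by
    intro h0
    rw [h0, map_zero] at hRC
    exact hC (by rw [← hRC, map_zero])
  refine hx0 ?_
  rw [← hfix]
  refine hζ.complete x fun k => ?_
  have h1 := hζ.hasSum_apply x
  rw [hfix] at h1
  have h2 := h1.mapL (innerSL ℝ (ζ k))
  have h3 : HasSum (fun j => ⟪ζ k, ((1 + (γ j)⁻¹)⁻¹ * ⟪ζ j, x⟫) • ζ j⟫)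
      ((1 + (γ k)⁻¹)⁻¹ * ⟪ζ k, x⟫) := by
    convert hasSum_ite_eq k ((1 + (γ k)⁻¹)⁻¹ * ⟪ζ k, x⟫) using 1
    funext j
    rw [inner_smul_right, orthonormal_iff_ite.1 hζ.orthonormal k j]
    split_ifs with h1 h2 h2
    · rw [h1, mul_one]
    · exact absurd h1.symm h2
    · exact absurd h2.symm h1
    · rw [mul_zero]
  have h4 := h2.unique h3
  simp only [innerSL_apply_apply] at h4
  have hγk := hγ0 k
  have h5 : (1 + (γ k)⁻¹)⁻¹ < 1 := inv_lt_one_of_one_lt₀ (by linarith [inv_pos.2 hγk])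
  have : (1 - (1 + (γ k)⁻¹)⁻¹) * ⟪ζ k, x⟫ = 0 := by linarith
  rcases mul_eq_zero.1 this with h | h
  · linarith
  · exact h

theorem pen_bot {H₀ : Submodule ℝ H} [H₀.HasOrthogonalProjection] (h : H₀ = ⊥) (f : H) :
    pen H₀ f = f := by
  have : H₀.starProjection f = 0 := by
    have h1 : H₀.starProjection f ∈ H₀ := Submodule.starProjection_apply_mem H₀ f
    exact (Submodule.mem_bot ℝ).1 (h.le h1)
  rw [pen, this, sub_zero]

theorem J_bot {H₀ : Submodule ℝ H} [H₀.HasOrthogonalProjection] (h : H₀ = ⊥) (f : H) :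
    J H₀ f = ‖f‖ ^ 2 := by
  rw [J, pen_bot h]

/-- The embedding of a reproducing kernel Hilbert space with a continuous kernel on a compact
domain into `L2`, together with the factorization of the integral operator of the kernel. -/
theorem exists_embedding [TopologicalSpace T] [CompactSpace T] [IsFiniteMeasure τ]
    [CompleteSpace H] (hH : ∀ f : H, MemLp (f : T → ℝ) 2 τ) {H₀ : Submodule ℝ H}
    [H₀.HasOrthogonalProjection] (h0 : H₀ = ⊥)
    (hK : Continuous (Function.uncurry (penKernel (T := T) H₀))) {Kop : L2 τ →L[ℝ] L2 τ}
    (hKop : IsIntegralOperator τ (penKernel (T := T) H₀) Kop) :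
    ∃ ι : H →L[ℝ] L2 τ, (∀ f, ι f = toL2 hH f) ∧ Kop = ι ∘L ι.adjoint := by
  have hker : ∀ s t : T, penKernel (T := T) H₀ s t
      = ⟪RKHS.kerFun H s (1 : ℝ), RKHS.kerFun H t (1 : ℝ)⟫ := by
    intro s t
    rw [penKernel, pen_bot h0, RKHS.kerFun_inner]
    simp
  have hdiag : Continuous fun t : T => penKernel (T := T) H₀ t t := by
    have aux : ∀ k : T → T → ℝ, Continuous (Function.uncurry k) → Continuous fun t => k t t :=
      fun k hk => hk.comp (by fun_prop : Continuous fun t : T => (t, t))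
    exact aux _ hK
  -- Boundedness of the kernel on the diagonal bounds all evaluations uniformly, and the measure is
  -- finite, so `ι` is continuous.
  obtain ⟨c, hc⟩ := (isCompact_range hdiag).bddAbove
  have hc' : ∀ t : T, ‖RKHS.kerFun H t (1 : ℝ)‖ ≤ √(max c 0) := by
    intro t
    apply Real.le_sqrt_of_sq_le
    rw [← real_inner_self_eq_norm_sq, ← hker]
    exact (hc ⟨t, rfl⟩).trans (le_max_left _ _)
  have heval : ∀ (f : H) (t : T), f t = ⟪RKHS.kerFun H t (1 : ℝ), f⟫ := by
    intro f t
    rw [RKHS.kerFun_inner]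
    simp
  let ι₀ : H →ₗ[ℝ] L2 τ :=
    { toFun := toL2 hH
      map_add' := toL2_add hH
      map_smul' := toL2_smul hH }
  let ι : H →L[ℝ] L2 τ := ι₀.mkContinuous
    ((measureUnivNNReal τ : ℝ) ^ ((2 : ℝ≥0∞).toReal)⁻¹ * √(max c 0)) fun f => by
      have := Lp.norm_le_of_ae_bound (f := toL2 hH f) (C := √(max c 0) * ‖f‖) (by positivity) (by
        filter_upwards [(hH f).coeFn_toLp] with t ht
        rw [toL2, ht, heval]
        exact (norm_inner_le_norm _ _).trans (mul_le_mul_of_nonneg_right (hc' t) (norm_nonneg _)))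
      rw [mul_assoc]
      exact this
  have hι : ∀ f, ι f = toL2 hH f := fun f => rfl
  refine ⟨ι, hι, ?_⟩
  ext1 f
  apply Lp.ext
  refine (hKop f).trans ?_
  rw [ContinuousLinearMap.comp_apply, hι]
  filter_upwards [(hH (ι.adjoint f)).coeFn_toLp] with s hs
  -- By the reproducing property, `(ι ι* f)(s) = ⟨K_s, ι* f⟩ = ⟨ι K_s, f⟩`, which is the integral of
  -- `K(s, ·) f`.
  rw [toL2, hs, heval, ContinuousLinearMap.adjoint_inner_right, L2.inner_def]
  refine integral_congr_ae ?_
  filter_upwards [(hH (RKHS.kerFun H s (1 : ℝ))).coeFn_toLp] with t ht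
  rw [hι, toL2, ht, hker, heval, real_inner_comm]
  simp [mul_comm]

end Reduction

/-! ### Existence, uniqueness and continuity of the ridge estimate -/

section Existence

variable {E : Type*} [NormedAddCommGroup E] [InnerProductSpace ℝ E] [CompleteSpace E]
  {H : Type*} [NormedAddCommGroup H] [InnerProductSpace ℝ H] [CompleteSpace H]

/-- The ridge regression estimate of the slope exists, is unique and depends continuously on the
data. -/
theorem exists_ridge_estimate (ι : H →L[ℝ] E) (n : ℕ) {lam : ℝ} (hlam : 0 < lam) :
    ∃ b : (Fin n → E × ℝ) → H, Continuous b ∧ ∀ z β,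
      (∃ α : ℝ, ∀ (α' : ℝ) (β' : H),
        (1 / (n : ℝ)) * ∑ i, ((z i).2 - (α + ⟪(z i).1, ι β⟫)) ^ 2 + lam * ‖β‖ ^ 2
          ≤ (1 / (n : ℝ)) * ∑ i, ((z i).2 - (α' + ⟪(z i).1, ι β'⟫)) ^ 2 + lam * ‖β'‖ ^ 2)
        ↔ β = b z := by
  set c : ℝ := 1 / (n : ℝ) with hc
  have hc0 : 0 ≤ c := by positivity
  set xb : (Fin n → E × ℝ) → E := fun z => c • ∑ i, (z i).1 with hxb
  set u : (Fin n → E × ℝ) → Fin n → H := fun z i => ι.adjoint ((z i).1 - xb z) with hu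
  set A : (Fin n → E × ℝ) → H →L[ℝ] H := fun z =>
    c • ∑ i, InnerProductSpace.rankOne ℝ (u z i) (u z i) + lam • 1 with hA
  have hAin : ∀ z x h, ⟪A z x, h⟫ = c * ∑ i, ⟪u z i, x⟫ * ⟪u z i, h⟫ + lam * ⟪x, h⟫ := by
    intro z x h
    simp [hA, inner_add_left, inner_smul_left, sum_inner]
  -- Eliminating the intercept centers the predictors and leaves the normal equation `A z β = g z`.
  -- The ridge term makes `A z` coercive, so it is invertible, and inversion is continuous at units.
  have hunit : ∀ z, IsUnit (A z) := by
    intro z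
    refine ContinuousLinearMap.isUnit_of_forall_le_norm_inner_map (A z)
      (c := ⟨lam, hlam.le⟩) hlam fun x => ?_
    rw [hAin]
    refine le_trans ?_ (le_abs_self _)
    rw [real_inner_self_eq_norm_sq]
    have : 0 ≤ c * ∑ i, ⟪u z i, x⟫ * ⟪u z i, x⟫ :=
      mul_nonneg hc0 (Finset.sum_nonneg fun i _ => mul_self_nonneg _)
    change ‖x‖ ^ 2 * lam ≤ _
    linarith
  set g : (Fin n → E × ℝ) → H := fun z => c • ∑ i, (z i).2 • u z i with hg
  refine ⟨fun z => Ring.inverse (A z) (g z), ?_, fun z β => ?_⟩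
  · have hucont : ∀ i, Continuous fun z => u z i := fun i => by fun_prop
    have hAcont : Continuous A := by
      refine ((continuous_finsetSum _ fun i _ => ?_).const_smul c).add continuous_const
      exact ((InnerProductSpace.rankOne ℝ).continuous.comp (hucont i)).clm_apply (hucont i)
    have hgcont : Continuous g := by fun_prop
    refine Continuous.clm_apply ?_ hgcont
    rw [continuous_iff_continuousAt]
    intro z
    have h1 := NormedRing.inverse_continuousAt (hunit z).unit
    exact ContinuousAt.comp (f := A) (by simpa using h1) hAcont.continuousAt
  set b := Ring.inverse (A z) (g z) with hb
  have hAb : A z b = g z :=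
    congrArg (fun f : H →L[ℝ] H => f (g z)) (Ring.mul_inverse_cancel _ (hunit z))
  have hui : ∀ i h, ⟪u z i, h⟫ = ⟪(z i).1, ι h⟫ - ⟪xb z, ι h⟫ := by
    intro i h
    rw [hu, ContinuousLinearMap.adjoint_inner_left, inner_sub_left]
  have hnormal : ∀ h, c * ∑ i, ⟪u z i, b⟫ * ⟪u z i, h⟫ + lam * ⟪b, h⟫
      = c * ∑ i, (z i).2 * ⟪u z i, h⟫ := by
    intro h
    rw [← hAin, hAb]
    simp [hg, inner_smul_left, sum_inner]
  -- Written so that it also holds for `n = 0`, where `c = 0`.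
  have hcn : ∀ t : ℝ, c * (n * (c * t)) = c * t := by
    intro t
    rcases Nat.eq_zero_or_pos n with h | h
    · have : c = 0 := by rw [hc, h]; simp
      rw [this]; ring
    · have : (n : ℝ) ≠ 0 := by exact_mod_cast h.ne'
      rw [hc]; field_simp
  have hxbin : ∀ h, ⟪xb z, ι h⟫ = c * ∑ i, ⟪(z i).1, ι h⟫ := by
    intro h
    simp [hxb, inner_smul_left, sum_inner]
  have hcent : ∀ h, c * ∑ i, ⟪u z i, h⟫ = 0 := by
    intro h
    simp_rw [hui, Finset.sum_sub_distrib, hxbin]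
    simp only [Finset.sum_const, Finset.card_univ, Fintype.card_fin, nsmul_eq_mul]
    rw [mul_sub, hcn, sub_self]
  set yb := c * ∑ i, (z i).2 with hyb
  set a₀ := yb - ⟪xb z, ι b⟫ with ha₀
  set r : Fin n → ℝ := fun i => (z i).2 - (a₀ + ⟪(z i).1, ι b⟫) with hr
  have hr' : ∀ i, r i = (z i).2 - yb - ⟪u z i, b⟫ := by
    intro i
    simp only [hr, ha₀, hui]; ring
  have hr0 : c * ∑ i, r i = 0 := by
    simp_rw [hr', Finset.sum_sub_distrib]
    simp only [Finset.sum_const, Finset.card_univ, Fintype.card_fin, nsmul_eq_mul]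
    rw [mul_sub, mul_sub, hcent, hyb, hcn]
    ring
  have hr1 : ∀ h, c * ∑ i, r i * ⟪(z i).1, ι h⟫ = lam * ⟪b, h⟫ := by
    intro h
    have e1 : ∀ i, r i * ⟪(z i).1, ι h⟫ = (z i).2 * ⟪u z i, h⟫ - yb * ⟪u z i, h⟫
        - ⟪u z i, b⟫ * ⟪u z i, h⟫ + r i * ⟪xb z, ι h⟫ := by
      intro i
      have := hui i h
      rw [show ⟪(z i).1, ι h⟫ = ⟪u z i, h⟫ + ⟪xb z, ι h⟫ by linarith, mul_add, hr']
      ring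
    simp_rw [e1, Finset.sum_add_distrib, Finset.sum_sub_distrib, ← Finset.mul_sum,
      ← Finset.sum_mul]
    have h1 := hnormal h
    have h2 := hcent h
    linear_combination -h1 - yb * h2 + ⟪xb z, ι h⟫ * hr0
  -- Exact expansion around `(a₀, b)`: the cross terms cancel by the normal equations `hr0` and
  -- `hr1`. The remaining excess contains `lam * ‖β' - b‖ ^ 2`, whence uniqueness of the slope.
  have hexp : ∀ (α' : ℝ) (β' : H),
      c * ∑ i, ((z i).2 - (α' + ⟪(z i).1, ι β'⟫)) ^ 2 + lam * ‖β'‖ ^ 2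
        = c * ∑ i, ((z i).2 - (a₀ + ⟪(z i).1, ι b⟫)) ^ 2 + lam * ‖b‖ ^ 2
          + (c * ∑ i, ((α' - a₀) + ⟪(z i).1, ι (β' - b)⟫) ^ 2 + lam * ‖β' - b‖ ^ 2) := by
    intro α' β'
    have e1 : ∀ i, ((z i).2 - (α' + ⟪(z i).1, ι β'⟫)) ^ 2 =
        ((z i).2 - (a₀ + ⟪(z i).1, ι b⟫)) ^ 2 + ((α' - a₀) + ⟪(z i).1, ι (β' - b)⟫) ^ 2
        - 2 * (α' - a₀) * r i - 2 * (r i * ⟪(z i).1, ι (β' - b)⟫) := by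
      intro i
      simp only [hr, map_sub, inner_sub_right]
      ring
    simp_rw [e1, Finset.sum_sub_distrib, Finset.sum_add_distrib, ← Finset.mul_sum]
    have h1 := hr1 (β' - b)
    have h2 : ‖β'‖ ^ 2 = ‖b‖ ^ 2 + 2 * ⟪b, β' - b⟫ + ‖β' - b‖ ^ 2 := by
      rw [← norm_add_sq_real, add_sub_cancel]
    rw [h2]
    linear_combination (-2) * h1 - 2 * (α' - a₀) * hr0
  have hnn : ∀ (α' : ℝ) (β' : H), 0 ≤ c * ∑ i, ((α' - a₀) + ⟪(z i).1, ι (β' - b)⟫) ^ 2 :=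
    fun α' β' => mul_nonneg hc0 (Finset.sum_nonneg fun i _ => sq_nonneg _)
  constructor
  · rintro ⟨α, hα⟩
    have h1 := hα a₀ b
    rw [hexp α β] at h1
    have h2 := hnn α β
    have h3 : lam * ‖β - b‖ ^ 2 ≤ 0 := by linarith
    have h4 : ‖β - b‖ ^ 2 ≤ 0 := by
      by_contra! hlt
      nlinarith [mul_pos hlam hlt]
    have h5 : ‖β - b‖ = 0 := by
      have := sq_nonneg ‖β - b‖
      exact pow_eq_zero_iff two_ne_zero |>.1 (le_antisymm h4 this)
    exact sub_eq_zero.1 (norm_eq_zero.1 h5)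
  · rintro rfl
    refine ⟨a₀, fun α' β' => ?_⟩
    rw [hexp α' β']
    have h2 := hnn α' β'
    have h3 : 0 ≤ lam * ‖β' - b‖ ^ 2 := by positivity
    linarith

end Existence

/-! ### Intercept and centered coordinates as features; risk of the ridge estimate -/

/-- The sequence with first term `a` and remaining terms `f`. -/
def headTail (a : ℝ) (f : ℕ → ℝ) : ℕ → ℝ
  | 0 => a
  | k + 1 => f k

theorem summable_headTail {a : ℝ} {f : ℕ → ℝ} (h : Summable f) : Summable (headTail a f) :=
  (summable_nat_add_iff 1).1 h

theorem tsum_headTail {a : ℝ} {f : ℕ → ℝ} (h : Summable f) :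
    ∑' k, headTail a f k = a + ∑' k, f k :=
  (summable_headTail h).tsum_eq_zero_add

section Upper

variable {T : Type*} [MeasurableSpace T] {τ : Measure T}

/-- The features of the linear model: the intercept and the centered coordinates. -/
noncomputable def feature (m : L2 τ) (ψ : ℕ → L2 τ) : ℕ → L2 τ → ℝ
  | 0, _ => 1
  | k + 1, x => ⟪ψ k, x - m⟫

theorem continuous_feature (m : L2 τ) (ψ : ℕ → L2 τ) (k : ℕ) : Continuous (feature m ψ k) := by
  cases k with
  | zero => exact continuous_const
  | succ k =>
    change Continuous fun x => ⟪ψ k, x - m⟫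
    fun_prop

section FeatureMoments

variable {F : Measure (L2 τ)} [IsProbabilityMeasure F] {μ : ℕ → ℝ} {ψ : ℕ → L2 τ} {M : ℝ}

/-- This is where the common eigenfunctions enter: `C` is diagonal in `ψ`, and centering makes the
intercept orthogonal to the other features. -/
theorem integral_feature_mul (hF : MemLp id 2 F) (hψ : IsEigenSystem (covOp F) μ ψ) (j k : ℕ) :
    ∫ x, feature (∫ x', x' ∂F) ψ j x * feature (∫ x', x' ∂F) ψ k x ∂F
      = if j = k then headTail 1 μ j else 0 := by
  have hint : Integrable (fun x : L2 τ => x) F := hF.integrable one_le_two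
  have hmean : ∀ k, ∫ x, ⟪ψ k, x - ∫ x', x' ∂F⟫ ∂F = 0 := by
    intro k
    have h1 := integral_inner (𝕜 := ℝ) (hint.sub (integrable_const (∫ x', x' ∂F))) (ψ k)
    simp only [Pi.sub_apply] at h1
    rw [h1, integral_sub hint (integrable_const _)]
    simp
  cases j with
  | zero =>
    cases k with
    | zero => simp [feature, headTail]
    | succ k => simpa [feature, headTail] using hmean k
  | succ j =>
    cases k with
    | zero => simpa [feature, headTail] using hmean j
    | succ k =>
      have h1 := inner_covOp F (ψ j) (ψ k)
      rw [hψ.apply_eq, inner_smul_left, orthonormal_iff_ite.1 hψ.orthonormal,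
        covarianceBilin_apply hF] at h1
      simp only [feature, headTail, Nat.add_right_cancel_iff]
      simp only [id] at h1
      rw [← h1]
      split_ifs <;> simp

/-- The constant becomes `max M 1` to cover the constant feature. -/
theorem integral_feature_pow_four (hF : MemLp id 2 F) (hψ : IsEigenSystem (covOp F) μ ψ)
    (h4 : ∀ f : L2 τ, Integrable (fun x => ⟪f, x - ∫ x', x' ∂F⟫ ^ 4) F ∧
      ∫ x, ⟪f, x - ∫ x', x' ∂F⟫ ^ 4 ∂F ≤ M * (∫ x, ⟪f, x - ∫ x', x' ∂F⟫ ^ 2 ∂F) ^ 2) (k : ℕ) :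
    Integrable (fun x => feature (∫ x', x' ∂F) ψ k x ^ 4) F ∧
      ∫ x, feature (∫ x', x' ∂F) ψ k x ^ 4 ∂F ≤ max M 1 * headTail 1 μ k ^ 2 := by
  cases k with
  | zero => simp [feature, headTail]
  | succ k =>
    obtain ⟨h1, h2⟩ := h4 (ψ k)
    refine ⟨h1, ?_⟩
    have h3 := integral_feature_mul hF hψ (k + 1) (k + 1)
    simp only [feature, headTail, if_true, ← sq] at h3 ⊢
    rw [h3] at h2
    exact h2.trans (mul_le_mul_of_nonneg_right (le_max_left _ _) (sq_nonneg _))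

theorem feature_mul_sq (hF : MemLp id 2 F) (hψ : IsEigenSystem (covOp F) μ ψ)
    (hμ : ∀ k, 0 < μ k)
    (h4 : ∀ f : L2 τ, Integrable (fun x => ⟪f, x - ∫ x', x' ∂F⟫ ^ 4) F ∧
      ∫ x, ⟪f, x - ∫ x', x' ∂F⟫ ^ 4 ∂F ≤ M * (∫ x, ⟪f, x - ∫ x', x' ∂F⟫ ^ 2 ∂F) ^ 2) (j k : ℕ) :
    Integrable (fun x => (feature (∫ x', x' ∂F) ψ j x * feature (∫ x', x' ∂F) ψ k x) ^ 2) F ∧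
      ∫ x, (feature (∫ x', x' ∂F) ψ j x * feature (∫ x', x' ∂F) ψ k x) ^ 2 ∂F
        ≤ max M 1 * (headTail 1 μ j * headTail 1 μ k) := by
  set φ := feature (∫ x', x' ∂F) ψ
  set v := headTail 1 μ
  have hv : ∀ k, 0 < v k := by
    intro k
    cases k with
    | zero => exact one_pos
    | succ k => exact hμ k
  obtain ⟨hj1, hj2⟩ := integral_feature_pow_four hF hψ h4 j
  obtain ⟨hk1, hk2⟩ := integral_feature_pow_four hF hψ h4 k
  have hvj := hv j
  have hvk := hv k
  -- The weights `p` and `q` balance the two fourth moments, so the weighted arithmetic–geometric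
  -- mean inequality already gives the order `v j * v k`.
  set p := v k / v j / 2
  set q := v j / v k / 2
  have hpt : ∀ x, (φ j x * φ k x) ^ 2 ≤ p * φ j x ^ 4 + q * φ k x ^ 4 := by
    intro x
    have e : p * φ j x ^ 4 + q * φ k x ^ 4 - (φ j x * φ k x) ^ 2
        = (v k * φ j x ^ 2 - v j * φ k x ^ 2) ^ 2 / (2 * v j * v k) := by
      simp only [p, q]
      field_simp
      ring
    have : 0 ≤ (v k * φ j x ^ 2 - v j * φ k x ^ 2) ^ 2 / (2 * v j * v k) := by positivity
    linarith
  have hg : Integrable (fun x => p * φ j x ^ 4 + q * φ k x ^ 4) F :=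
    (hj1.const_mul p).add (hk1.const_mul q)
  have hi : Integrable (fun x => (φ j x * φ k x) ^ 2) F := by
    refine hg.mono' ?_ (ae_of_all _ fun x => ?_)
    · exact (((continuous_feature _ ψ j).mul (continuous_feature _ ψ k)).pow
        2).measurable.aestronglyMeasurable
    · rw [Real.norm_of_nonneg (sq_nonneg _)]
      exact hpt x
  refine ⟨hi, (integral_mono hi hg hpt).trans ?_⟩
  rw [integral_add (hj1.const_mul p) (hk1.const_mul q), integral_const_mul, integral_const_mul]
  have hp : 0 ≤ p := by positivity
  have hq : 0 ≤ q := by positivity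
  calc p * ∫ x, φ j x ^ 4 ∂F + q * ∫ x, φ k x ^ 4 ∂F
      ≤ p * (max M 1 * v j ^ 2) + q * (max M 1 * v k ^ 2) := by gcongr
    _ = max M 1 * (v j * v k) := by
      simp only [p, q]
      field_simp
      ring

end FeatureMoments

variable {H : Type*} [NormedAddCommGroup H] [InnerProductSpace ℝ H] [CompleteSpace H]

/-- On the event that the empirical moments are close to the population moments, the weighted
error of the regularized estimate is controlled. -/
theorem ridge_error_bound {ι : H →L[ℝ] L2 τ} {ρ μ : ℕ → ℝ} {ψ : ℕ → L2 τ}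
    (hψ : IsEigenSystem (ι ∘L ι.adjoint) ρ ψ) (hρ : ∀ k, 0 < ρ k) (hμ : ∀ k, 0 < μ k)
    (hμa : Antitone μ) {n : ℕ} {lam B ζ κ : ℝ} (hlam : 0 < lam) (hκ : 0 < κ)
    (hκle : ∀ k, κ ≤ μ k + lam / ρ k) (m : L2 τ) (α₀ : ℝ) {β₀ b : H} (hB : ‖β₀‖ ^ 2 ≤ B)
    (z : Fin n → L2 τ × ℝ) {α : ℝ}
    (hmin : (1 / (n : ℝ)) * ∑ i, ((z i).2 - (α + ⟪(z i).1, ι b⟫)) ^ 2 + lam * ‖b‖ ^ 2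
      ≤ (1 / (n : ℝ)) * ∑ i, ((z i).2 - (α₀ + ⟪(z i).1, ι β₀⟫)) ^ 2 + lam * ‖β₀‖ ^ 2)
    (hH : ∀ N, ∑ q ∈ Finset.range N ×ˢ Finset.range N,
      ((1 / (n : ℝ)) * ∑ i, feature m ψ q.1 (z i).1 * feature m ψ q.2 (z i).1
        - if q.1 = q.2 then headTail 1 μ q.1 else 0) ^ 2
        / (headTail 1 (fun k => μ k + lam / ρ k) q.1
          * headTail 1 (fun k => μ k + lam / ρ k) q.2) ≤ 1 / 16)
    (hZ : ∀ N, ∑ k ∈ Finset.range N,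
      ((1 / (n : ℝ)) * ∑ i, ((z i).2 - (α₀ + ⟪(z i).1, ι β₀⟫)) * feature m ψ k (z i).1) ^ 2
        / headTail 1 (fun k => μ k + lam / ρ k) k ≤ ζ) :
    ‖ι b - ι β₀‖ ^ 2 ≤ κ⁻¹ * (64 * ζ + 16 * (lam * B)) := by
  set Δ := b - β₀ with hΔ
  -- As the coordinates are centered at `m`, the intercept error absorbs `⟪m, ι Δ⟫`.
  set d : ℕ → ℝ := headTail (α - α₀ + ⟪m, ι Δ⟫) fun k => ⟪ψ k, ι Δ⟫ with hd
  set f : Fin n → ℝ := fun i => α - α₀ + ⟪(z i).1, ι Δ⟫ with hf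
  obtain ⟨hps, hpb⟩ := penalty_bessel hψ hρ Δ
  have hL := hasSum_norm_sq_of_range hψ Δ
  have hw : headTail 1 (fun k => μ k + lam / ρ k)
      = fun k => headTail 1 μ k + headTail 0 (fun k => lam / ρ k) k := by
    funext k
    cases k <;> simp [headTail]
  have hsa : Summable fun k => lam / ρ k * ⟪ψ k, ι Δ⟫ ^ 2 := by
    have e : (fun k => lam / ρ k * ⟪ψ k, ι Δ⟫ ^ 2) = fun k => lam * (⟪ψ k, ι Δ⟫ ^ 2 / ρ k) :=
      funext fun k => by ring
    rw [e]
    exact hps.mul_left lam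
  have hsμ : Summable fun k => μ k * ⟪ψ k, ι Δ⟫ ^ 2 :=
    (hL.summable.mul_left (μ 0)).of_nonneg_of_le
      (fun k => mul_nonneg (hμ k).le (sq_nonneg _))
      fun k => mul_le_mul_of_nonneg_right (hμa (Nat.zero_le k)) (sq_nonneg _)
  have hsw : Summable fun k => (μ k + lam / ρ k) * ⟪ψ k, ι Δ⟫ ^ 2 := by
    have e : (fun k => (μ k + lam / ρ k) * ⟪ψ k, ι Δ⟫ ^ 2)
        = fun k => μ k * ⟪ψ k, ι Δ⟫ ^ 2 + lam / ρ k * ⟪ψ k, ι Δ⟫ ^ 2 :=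
      funext fun k => add_mul _ _ _
    rw [e]
    exact hsμ.add hsa
  have hfun : (fun k => (headTail 1 μ k + headTail 0 (fun k => lam / ρ k) k) * d k ^ 2)
      = headTail ((α - α₀ + ⟪m, ι Δ⟫) ^ 2) fun k => (μ k + lam / ρ k) * ⟪ψ k, ι Δ⟫ ^ 2 := by
    funext k
    cases k <;> simp [headTail, hd]
  have hfuna : (fun k => headTail 0 (fun k => lam / ρ k) k * d k ^ 2)
      = headTail 0 fun k => lam / ρ k * ⟪ψ k, ι Δ⟫ ^ 2 := by
    funext k
    cases k <;> simp [headTail, hd]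
  have horacle := weighted_oracle_bound (n := n) (fun k i => feature m ψ k (z i).1)
    (fun i => (z i).2 - (α₀ + ⟪(z i).1, ι β₀⟫)) f (headTail 1 μ)
    (headTail 0 fun k => lam / ρ k) d (ζ := ζ) (b := 2 * (lam * B))
    (by intro k; cases k with
        | zero => exact zero_le_one
        | succ k => exact (hμ k).le)
    (by intro k; cases k with
        | zero => exact le_rfl
        | succ k => exact (div_pos hlam (hρ k)).le)
    (by intro k; cases k with
        | zero => simp [headTail]
        | succ k => exact add_pos (hμ k) (div_pos hlam (hρ k)))
    (by rw [hfun]; exact summable_headTail hsw)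
    (by
      intro i
      rw [← tendsto_add_atTop_iff_nat 1]
      have h1 := ((hasSum_of_range hψ Δ).mapL (innerSL ℝ ((z i).1 - m))).tendsto_sum_nat
      simp only [innerSL_apply_apply, inner_smul_right] at h1
      have h2 := h1.add_const (α - α₀ + ⟪m, ι Δ⟫)
      have e : f i = ⟪(z i).1 - m, ι Δ⟫ + (α - α₀ + ⟪m, ι Δ⟫) := by
        simp only [hf, inner_sub_left]; ring
      rw [e]
      refine h2.congr fun N => ?_
      rw [Finset.sum_range_succ']
      simp only [hd, headTail, feature, mul_one]
      congr 1
      refine Finset.sum_congr rfl fun k _ => ?_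
      rw [real_inner_comm (ψ k) ((z i).1 - m)])
    (by rw [hw] at hH; exact hH) (by rw [hw] at hZ; exact hZ)
    (by
      rw [hfuna, tsum_headTail hsa, zero_add]
      have e1 : ∀ i, ((z i).2 - (α + ⟪(z i).1, ι b⟫)) ^ 2
          = ((z i).2 - (α₀ + ⟪(z i).1, ι β₀⟫)) ^ 2 + f i ^ 2
            - 2 * (((z i).2 - (α₀ + ⟪(z i).1, ι β₀⟫)) * f i) := by
        intro i
        simp only [hf, hΔ, map_sub, inner_sub_right]
        ring
      simp_rw [e1, Finset.sum_sub_distrib, Finset.sum_add_distrib, ← Finset.mul_sum] at hmin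
      have e2 : ∑' k, lam / ρ k * ⟪ψ k, ι Δ⟫ ^ 2 ≤ lam * ‖Δ‖ ^ 2 := by
        refine le_trans (le_of_eq ?_) (mul_le_mul_of_nonneg_left hpb hlam.le)
        rw [← tsum_mul_left]
        exact tsum_congr fun k => by ring
      -- Hence `lam ‖b‖² ≥ lam ‖Δ‖² / 2 - lam ‖β₀‖²`: the source of the factor `1/2` in the oracle
      -- hypothesis and of its remainder `2 lam B`.
      have e3 : ‖Δ‖ ^ 2 ≤ 2 * ‖b‖ ^ 2 + 2 * ‖β₀‖ ^ 2 := by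
        have h1 := parallelogram_law_with_norm ℝ b β₀
        have h2 := mul_self_nonneg ‖b + β₀‖
        rw [hΔ]
        nlinarith
      have e4 := mul_le_mul_of_nonneg_left e3 hlam.le
      have e5 := mul_le_mul_of_nonneg_left hB hlam.le
      nlinarith)
  rw [hfun, tsum_headTail hsw] at horacle
  have h1 : κ * ‖ι Δ‖ ^ 2 ≤ ∑' k, (μ k + lam / ρ k) * ⟪ψ k, ι Δ⟫ ^ 2 := by
    rw [← hL.tsum_eq, ← tsum_mul_left]
    exact (hL.summable.mul_left κ).tsum_le_tsum
      (fun k => mul_le_mul_of_nonneg_right (hκle k) (sq_nonneg _)) hsw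
  have h2 := sq_nonneg (α - α₀ + ⟪m, ι Δ⟫)
  rw [← map_sub, ← hΔ, inv_mul_eq_div, le_div_iff₀ hκ]
  linarith

variable [SecondCountableTopology (L2 τ)] in
/-- A non-asymptotic bound for the risk of the regularized estimate. -/
theorem ridge_risk_bound {ι : H →L[ℝ] L2 τ} {ρ μ : ℕ → ℝ} {ψ : ℕ → L2 τ}
    (hψ : IsEigenSystem (ι ∘L ι.adjoint) ρ ψ) (hρ : ∀ k, 0 < ρ k) (hμ : ∀ k, 0 < μ k)
    {F : Measure (L2 τ)} [IsProbabilityMeasure F] (hF : MemLp id 2 F)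
    (hFψ : IsEigenSystem (covOp F) μ ψ) {M : ℝ}
    (h4 : ∀ f : L2 τ, Integrable (fun x => ⟪f, x - ∫ x', x' ∂F⟫ ^ 4) F ∧
      ∫ x, ⟪f, x - ∫ x', x' ∂F⟫ ^ 4 ∂F ≤ M * (∫ x, ⟪f, x - ∫ x', x' ∂F⟫ ^ 2 ∂F) ^ 2)
    {M₂ : ℝ} {G : Measure ℝ} (hG : G ∈ noiseClass M₂) {n : ℕ} (hn : 0 < n)
    {lam B ζ κ S u : ℝ} (hlam : 0 < lam) (hζ : 0 < ζ) (hκ : 0 < κ)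
    (hκle : ∀ k, κ ≤ μ k + lam / ρ k) (hS : Summable fun k => μ k / (μ k + lam / ρ k))
    (hSle : ∑' k, μ k / (μ k + lam / ρ k) ≤ S) (α₀ : ℝ) {β₀ : H} (hB : ‖β₀‖ ^ 2 ≤ B)
    {b : (Fin n → L2 τ × ℝ) → H}
    (hb : ∀ z, ∃ α : ℝ, ∀ (α' : ℝ) (β' : H),
      (1 / (n : ℝ)) * ∑ i, ((z i).2 - (α + ⟪(z i).1, ι (b z)⟫)) ^ 2 + lam * ‖b z‖ ^ 2
        ≤ (1 / (n : ℝ)) * ∑ i, ((z i).2 - (α' + ⟪(z i).1, ι β'⟫)) ^ 2 + lam * ‖β'‖ ^ 2)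
    (hu : κ⁻¹ * (64 * ζ + 16 * (lam * B)) ≤ u) :
    dataLaw n α₀ (ι β₀) F G {z | u < ‖ι (b z) - ι β₀‖ ^ 2}
      ≤ ENNReal.ofReal (16 * (max M 1 * (1 + S) ^ 2 / n)) +
        ENNReal.ofReal (M₂ * (1 + S) / n / ζ) := by
  obtain ⟨hGp, hG2, hG0, hGM⟩ := hG
  have hM₂ : 0 ≤ M₂ := (integral_nonneg fun e => sq_nonneg e).trans hGM
  set m : L2 τ := ∫ x', x' ∂F
  set Φ : L2 τ × ℝ → L2 τ × ℝ := fun p => (p.1, α₀ + ⟪p.1, ι β₀⟫ + p.2) with hΦ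
  have hΦm : Measurable Φ := measurable_observation α₀ (ι β₀)
  set P := (F.prod G).map Φ
  have hP : IsProbabilityMeasure P := Measure.isProbabilityMeasure_map hΦm.aemeasurable
  set φ : ℕ → L2 τ × ℝ → ℝ := fun k p => feature m ψ k p.1
  -- The noise is recovered from the observation, so all moments can be taken under the law `P` of
  -- one observation and computed on `F.prod G`.
  set ε : L2 τ × ℝ → ℝ := fun p => p.2 - (α₀ + ⟪p.1, ι β₀⟫) with hε
  have hφm : ∀ k, Measurable (φ k) := fun k =>
    (continuous_feature m ψ k).measurable.comp measurable_fst
  have hεm : Measurable ε := by fun_prop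
  have hεΦ : ∀ p, ε (Φ p) = p.2 := by
    intro p
    simp only [hε, hΦ]; ring
  set v := headTail 1 μ with hv
  have hvpos : ∀ k, 0 < v k := by
    intro k
    cases k with
    | zero => exact one_pos
    | succ k => exact hμ k
  set w := headTail 1 fun k => μ k + lam / ρ k with hw
  have hwpos : ∀ k, 0 < w k := by
    intro k
    cases k with
    | zero => exact one_pos
    | succ k => exact add_pos (hμ k) (div_pos hlam (hρ k))
  have hratio : (fun k => v k / w k) = headTail 1 fun k => μ k / (μ k + lam / ρ k) := by
    funext k
    cases k <;> simp [hv, hw, headTail]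
  have hrs : Summable fun k => v k / w k := by
    rw [hratio]; exact summable_headTail hS
  have hrle : ∑' k, v k / w k ≤ 1 + S := by
    rw [hratio, tsum_headTail hS]; linarith
  have hr0 : 0 ≤ ∑' k, v k / w k := tsum_nonneg fun k => div_nonneg (hvpos k).le (hwpos k).le
  have hmap : ∀ g : L2 τ × ℝ → ℝ, Measurable g → ∫ p, g p ∂P = ∫ p, g (Φ p) ∂(F.prod G) :=
    fun g hg => integral_map hΦm.aemeasurable hg.aestronglyMeasurable
  have hmemP : ∀ g : L2 τ × ℝ → ℝ, Measurable g →
      Integrable (fun p => g (Φ p) ^ 2) (F.prod G) → MemLp g 2 P := by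
    intro g hg hi
    rw [memLp_map_measure_iff hg.aestronglyMeasurable hΦm.aemeasurable]
    exact (memLp_two_iff_integrable_sq (hg.comp hΦm).aestronglyMeasurable).2 hi
  have hφsq : ∀ k, Integrable (fun x => feature m ψ k x ^ 2) F := by
    intro k
    have := (feature_mul_sq hF hFψ hμ h4 0 k).1
    simpa [feature] using this
  have hGsq : Integrable (fun e : ℝ => e ^ 2) G := hG2.integrable_sq
  have hmain := empirical_moments_bound hn P φ ε v w (M := max M 1) (M₂ := M₂) (ζ := ζ)
    (le_max_of_le_right zero_le_one) hM₂ hζ (fun k => (hvpos k).le) hwpos hrs hφm hεm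
    (fun j k => hmemP _ ((hφm j).fun_mul (hφm k)) (by
      have := (feature_mul_sq hF hFψ hμ h4 j k).1
      exact this.comp_fst G))
    (fun j k => by
      rw [hmap _ ((hφm j).fun_mul (hφm k))]
      have h1 := integral_fun_fst (μ := F) (ν := G)
        (fun x => feature m ψ j x * feature m ψ k x)
      rw [probReal_univ, one_smul, integral_feature_mul hF hFψ] at h1
      exact h1)
    (fun j k => by
      rw [hmap _ (((hφm j).fun_mul (hφm k)).pow_const 2)]
      have h1 := integral_fun_fst (μ := F) (ν := G)
        (fun x => (feature m ψ j x * feature m ψ k x) ^ 2)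
      rw [probReal_univ, one_smul] at h1
      exact h1.le.trans (feature_mul_sq hF hFψ hμ h4 j k).2)
    (fun k => hmemP _ (hεm.fun_mul (hφm k)) (by
      simp only [hεΦ, mul_pow]
      have := (hφsq k).mul_prod hGsq
      simpa only [mul_comm] using this))
    (fun k => by
      rw [hmap _ (hεm.fun_mul (hφm k))]
      simp only [hεΦ]
      have h1 := integral_prod_mul (μ := F) (ν := G) (fun x => feature m ψ k x) fun e : ℝ => e
      rw [hG0, mul_zero] at h1
      rw [← h1]
      exact integral_congr_ae (ae_of_all _ fun p => mul_comm _ _))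
    (fun k => by
      rw [hmap _ ((hεm.fun_mul (hφm k)).pow_const 2)]
      simp only [hεΦ]
      have h1 := integral_prod_mul (μ := F) (ν := G) (fun x => feature m ψ k x ^ 2)
        fun e : ℝ => e ^ 2
      have h2 := integral_feature_mul hF hFψ k k
      simp only [if_true, ← sq] at h2
      rw [h2] at h1
      have h3 : ∫ p, (p.2 * φ k (Φ p)) ^ 2 ∂(F.prod G) = v k * ∫ e, e ^ 2 ∂G := by
        rw [← h1]
        exact integral_congr_ae (ae_of_all _ fun p => by
          simp only [φ, hΦ]; ring)
      rw [h3, mul_comm]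
      exact mul_le_mul_of_nonneg_right hGM (hvpos k).le)
  refine (measure_mono ?_).trans (hmain.trans ?_)
  · intro z hz hgood
    obtain ⟨α, hα⟩ := hb z
    refine not_le.2 hz (le_trans ?_ hu)
    exact ridge_error_bound hψ hρ hμ hFψ.antitone hlam hκ hκle m α₀ hB z (hα α₀ β₀)
      hgood.1 hgood.2
  · have hn' : (0 : ℝ) < n := by exact_mod_cast hn
    have : 0 ≤ max M 1 := le_max_of_le_right zero_le_one
    gcongr

end Upper

/-! ### Effective dimension and size of the weights -/

section Rates

/-- On `ℕ` the finitely many exceptional indices are absorbed into the constants. The proviso `g k ≠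
0` is there for rates in `n`: a negative power of `0` is `0` by convention. -/
theorem bounds_of_isTheta {f g : ℕ → ℝ} (h : f =Θ[atTop] g) (hf : ∀ k, 0 < f k)
    (hg : ∀ k, 0 ≤ g k) :
    ∃ c C : ℝ, 0 < c ∧ 0 < C ∧ ∀ k, c * g k ≤ f k ∧ (g k ≠ 0 → f k ≤ C * g k) := by
  obtain ⟨C, hC, h1⟩ := Asymptotics.bound_of_isBigO_nat_atTop h.1
  obtain ⟨c, hc, h2⟩ := Asymptotics.bound_of_isBigO_nat_atTop h.2
  refine ⟨c⁻¹, C, inv_pos.2 hc, hC, fun k => ⟨?_, fun hk => ?_⟩⟩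
  · have := h2 (hf k).ne'
    rw [Real.norm_of_nonneg (hg k), Real.norm_of_nonneg (hf k).le] at this
    rwa [inv_mul_le_iff₀ hc]
  · have := h1 hk
    rwa [Real.norm_of_nonneg (hg k), Real.norm_of_nonneg (hf k).le] at this

/-- Each term is at most `1 / (L + k) - 1 / (L + k + 1)`, and the sum telescopes. -/
theorem sum_inv_sq_le {L : ℝ} (hL : 0 < L) :
    (Summable fun k : ℕ => 1 / (L + ((k : ℝ) + 1)) ^ 2) ∧
      ∑' k : ℕ, 1 / (L + ((k : ℝ) + 1)) ^ 2 ≤ 1 / L := by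
  have hpart : ∀ n, ∑ k ∈ Finset.range n, 1 / (L + ((k : ℝ) + 1)) ^ 2 ≤ 1 / L := by
    intro n
    have hterm : ∀ k : ℕ, 1 / (L + ((k : ℝ) + 1)) ^ 2
        ≤ 1 / (L + (k : ℝ)) - 1 / (L + ((k + 1 : ℕ) : ℝ)) := by
      intro k
      have hk : (0 : ℝ) ≤ k := Nat.cast_nonneg k
      have e : 1 / (L + (k : ℝ)) - 1 / (L + ((k + 1 : ℕ) : ℝ))
          = 1 / ((L + k) * (L + (k + 1))) := by
        push_cast
        field_simp
        ring
      rw [e]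
      apply one_div_le_one_div_of_le (by positivity)
      nlinarith
    refine (Finset.sum_le_sum fun k _ => hterm k).trans ?_
    rw [Finset.sum_range_sub' fun k : ℕ => 1 / (L + (k : ℝ))]
    have : 0 ≤ 1 / (L + (n : ℝ)) := by positivity
    simp only [Nat.cast_zero, add_zero]
    linarith
  have hs := summable_of_sum_range_le (f := fun k : ℕ => 1 / (L + ((k : ℝ) + 1)) ^ 2)
    (fun k => by positivity) hpart
  exact ⟨hs, hs.tsum_le_of_sum_range_le hpart⟩

variable {μ ρ : ℕ → ℝ} {A c r s L : ℝ}

/-- The effective dimension of the regularized problem is at most of order `L`, when the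
regularization parameter is `L ^ (-2 (r + s))`. -/
theorem effective_dimension_bound (hμ : ∀ k, 0 < μ k) (hρ : ∀ k, 0 < ρ k)
    (hμA : ∀ k : ℕ, μ k ≤ A * ((k : ℝ) + 1) ^ (-2 * s))
    (hρc : ∀ k : ℕ, ρ k ≤ c * ((k : ℝ) + 1) ^ (-2 * r)) (hL : 0 < L) (hrs : 1 ≤ r + s) :
    (Summable fun k => μ k / (μ k + L ^ (-(2 * (r + s))) / ρ k)) ∧
      ∑' k, μ k / (μ k + L ^ (-(2 * (r + s))) / ρ k) ≤ 4 * max 1 (A * c) * L := by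
  set D := max 1 (A * c)
  have hD1 : 1 ≤ D := le_max_left _ _
  -- One majorant serves both regimes. Up to `L` the ratio is at most `1`; beyond, it is at most `A
  -- c (L / x)^{2(r+s)}`, and `r + s ≥ 1` lowers the exponent to `2`.
  have hterm : ∀ k : ℕ, μ k / (μ k + L ^ (-(2 * (r + s))) / ρ k)
      ≤ 4 * D * L ^ 2 * (1 / (L + ((k : ℝ) + 1)) ^ 2) := by
    intro k
    set x : ℝ := (k : ℝ) + 1 with hx
    have hx0 : 0 < x := by positivity
    have hμk := hμ k
    have hρk := hρ k
    have hlam : 0 < L ^ (-(2 * (r + s))) := Real.rpow_pos_of_pos hL _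
    rcases le_or_gt x L with h | h
    · have h1 : μ k / (μ k + L ^ (-(2 * (r + s))) / ρ k) ≤ 1 := by
        rw [div_le_one (by positivity)]
        have : 0 < L ^ (-(2 * (r + s))) / ρ k := by positivity
        linarith
      have h2 : 1 ≤ 4 * L ^ 2 * (1 / (L + x) ^ 2) := by
        rw [mul_one_div, one_le_div (by positivity)]
        nlinarith
      have h3 : 4 * L ^ 2 * (1 / (L + x) ^ 2) ≤ D * (4 * L ^ 2 * (1 / (L + x) ^ 2)) :=
        le_mul_of_one_le_left (by positivity) hD1
      linarith
    · have h1 : μ k / (μ k + L ^ (-(2 * (r + s))) / ρ k) ≤ μ k * ρ k * L ^ (2 * (r + s)) := by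
        have e : μ k * ρ k * L ^ (2 * (r + s)) = μ k / (L ^ (-(2 * (r + s))) / ρ k) := by
          rw [Real.rpow_neg hL.le]
          field_simp
        rw [e]
        exact div_le_div_of_nonneg_left hμk.le (by positivity) (by linarith)
      have h2 : μ k * ρ k ≤ A * c * x ^ (-(2 * (r + s))) := by
        have := mul_le_mul (hμA k) (hρc k) hρk.le (hμk.le.trans (hμA k))
        refine this.trans (le_of_eq ?_)
        rw [show -(2 * (r + s)) = -2 * s + -2 * r by ring, Real.rpow_add hx0]
        ring
      have h3 : x ^ (-(2 * (r + s))) * L ^ (2 * (r + s)) = (L / x) ^ (2 * (r + s)) := by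
        rw [Real.div_rpow hL.le hx0.le, Real.rpow_neg hx0.le]
        field_simp
      have hlx : L / x ≤ 1 := (div_le_one hx0).2 h.le
      have h4 : (L / x) ^ (2 * (r + s)) ≤ (L / x) ^ 2 := by
        rw [← Real.rpow_natCast (L / x) 2]
        exact Real.rpow_le_rpow_of_exponent_ge (by positivity) hlx (by push_cast; linarith)
      have h5 : (L / x) ^ 2 ≤ 4 * L ^ 2 * (1 / (L + x) ^ 2) := by
        rw [div_pow, mul_one_div, div_le_div_iff₀ (by positivity) (by positivity)]
        have : (L + x) ^ 2 ≤ 4 * x ^ 2 := by nlinarith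
        nlinarith [sq_nonneg L, mul_le_mul_of_nonneg_left this (sq_nonneg L)]
      calc μ k / (μ k + L ^ (-(2 * (r + s))) / ρ k)
          ≤ μ k * ρ k * L ^ (2 * (r + s)) := h1
        _ ≤ A * c * x ^ (-(2 * (r + s))) * L ^ (2 * (r + s)) := by gcongr
        _ = A * c * (L / x) ^ (2 * (r + s)) := by rw [mul_assoc, h3]
        _ ≤ D * (L / x) ^ (2 * (r + s)) := by gcongr; exact le_max_right _ _
        _ ≤ D * (4 * L ^ 2 * (1 / (L + x) ^ 2)) :=
            mul_le_mul_of_nonneg_left (h4.trans h5) (by linarith)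
        _ = _ := by ring
  obtain ⟨hs1, hs2⟩ := sum_inv_sq_le hL
  have hnn : ∀ k, 0 ≤ μ k / (μ k + L ^ (-(2 * (r + s))) / ρ k) := fun k =>
    div_nonneg (hμ k).le (add_pos (hμ k) (div_pos (Real.rpow_pos_of_pos hL _) (hρ k))).le
  have hsum := (hs1.mul_left (4 * D * L ^ 2)).of_nonneg_of_le hnn hterm
  refine ⟨hsum, (hsum.tsum_le_tsum hterm (hs1.mul_left _)).trans ?_⟩
  rw [tsum_mul_left]
  calc 4 * D * L ^ 2 * ∑' k : ℕ, 1 / (L + ((k : ℝ) + 1)) ^ 2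
      ≤ 4 * D * L ^ 2 * (1 / L) := by gcongr
    _ = 4 * D * L := by field_simp

/-- The decreasing term `μ k` suffices for indices up to `L`, the growing term `λ / ρ k` beyond;
both are of order `L^{-2s}` at the crossing. -/
theorem weight_lower_bound (hρ : ∀ k, 0 < ρ k) (hμ : ∀ k, 0 < μ k) (hA : 0 < A) (hc : 0 < c)
    (hμA : ∀ k : ℕ, A⁻¹ * ((k : ℝ) + 1) ^ (-2 * s) ≤ μ k)
    (hρc : ∀ k : ℕ, ρ k ≤ c * ((k : ℝ) + 1) ^ (-2 * r)) (hL : 0 < L) (hr : 0 < r) (hs : 0 < s)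
    (k : ℕ) :
    min A⁻¹ c⁻¹ * L ^ (-(2 * s)) ≤ μ k + L ^ (-(2 * (r + s))) / ρ k := by
  set x : ℝ := (k : ℝ) + 1 with hx
  have hx0 : 0 < x := by positivity
  have hlam : 0 < L ^ (-(2 * (r + s))) := Real.rpow_pos_of_pos hL _
  have hq : 0 < L ^ (-(2 * s)) := Real.rpow_pos_of_pos hL _
  have hρk := hρ k
  have hμk := hμ k
  rcases le_or_gt x L with h | h
  · have h1 : L ^ (-(2 * s)) ≤ x ^ (-2 * s) := by
      rw [show -2 * s = -(2 * s) by ring]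
      exact Real.rpow_le_rpow_of_nonpos hx0 h (by linarith)
    have h2 : 0 < L ^ (-(2 * (r + s))) / ρ k := by positivity
    have h3 : min A⁻¹ c⁻¹ * L ^ (-(2 * s)) ≤ A⁻¹ * x ^ (-2 * s) :=
      mul_le_mul (min_le_left _ _) h1 hq.le (inv_pos.2 hA).le
    linarith [hμA k]
  · have h1 : L ^ (2 * r) ≤ x ^ (2 * r) := Real.rpow_le_rpow hL.le h.le (by linarith)
    have h2 : c⁻¹ * L ^ (-(2 * s)) ≤ L ^ (-(2 * (r + s))) / ρ k := by
      have e1 : L ^ (-(2 * s)) = L ^ (-(2 * (r + s))) * L ^ (2 * r) := by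
        rw [← Real.rpow_add hL]; congr 1; ring
      have h3 : ρ k * x ^ (2 * r) ≤ c := by
        have := mul_le_mul_of_nonneg_right (hρc k) (Real.rpow_nonneg hx0.le (2 * r))
        rwa [mul_assoc, ← Real.rpow_add hx0, show -2 * r + 2 * r = 0 by ring, Real.rpow_zero,
          mul_one] at this
      rw [e1, le_div_iff₀ hρk]
      calc c⁻¹ * (L ^ (-(2 * (r + s))) * L ^ (2 * r)) * ρ k
          = c⁻¹ * L ^ (-(2 * (r + s))) * (ρ k * L ^ (2 * r)) := by ring
        _ ≤ c⁻¹ * L ^ (-(2 * (r + s))) * c := by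
          gcongr
          exact (mul_le_mul_of_nonneg_left h1 hρk.le).trans h3
        _ = L ^ (-(2 * (r + s))) := by field_simp
    have h3 : min A⁻¹ c⁻¹ * L ^ (-(2 * s)) ≤ c⁻¹ * L ^ (-(2 * s)) :=
      mul_le_mul_of_nonneg_right (min_le_right _ _) hq.le
    linarith

end Rates

/-! ### Consequences of membership in the classes -/

section Classes

variable {T : Type*} [MeasurableSpace T] {τ : Measure T}
  {H : Type*} [NormedAddCommGroup H] [InnerProductSpace ℝ H] [RKHS ℝ H T ℝ]
  {hH : ∀ f : H, MemLp (f : T → ℝ) 2 τ} {H₀ : Submodule ℝ H} [H₀.HasOrthogonalProjection]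
  {ρ : ℕ → ℝ} {ψ : ℕ → L2 τ} {s M A : ℝ} {F : Measure (L2 τ)}

theorem eigenvalue_nonneg {μ : ℕ → ℝ} {φ : ℕ → L2 τ} (h : IsEigenSystem (covOp F) μ φ) (k : ℕ) :
    0 ≤ μ k := by
  have h1 := inner_covOp F (φ k) (φ k)
  rw [h.apply_eq, inner_smul_left, real_inner_self_eq_norm_sq, h.orthonormal.1 k] at h1
  simp only [conj_trivial, one_pow, mul_one] at h1
  rw [h1]
  exact covarianceBilin_self_nonneg _

theorem integral_inner_eigenfunction_sq {μ : ℕ → ℝ} [IsProbabilityMeasure F] (hF : MemLp id 2 F)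
    (hmean : ∫ x, x ∂F = 0) (h : IsEigenSystem (covOp F) μ ψ) (c : ℝ) (k : ℕ) :
    ∫ x, ⟪x, c • ψ k⟫ ^ 2 ∂F = c ^ 2 * μ k := by
  have h1 := inner_covOp F (ψ k) (ψ k)
  rw [h.apply_eq, inner_smul_left, real_inner_self_eq_norm_sq, h.orthonormal.1 k,
    covarianceBilin_apply hF] at h1
  simp only [conj_trivial, one_pow, mul_one, id, hmean, sub_zero] at h1
  rw [h1, ← integral_const_mul]
  refine integral_congr_ae (ae_of_all _ fun x => ?_)
  simp only [inner_smul_right]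
  rw [real_inner_comm x]
  ring

theorem gaussian_mem_noiseClass {M₂ : ℝ} (hM₂ : 0 < M₂) :
    gaussianReal 0 M₂.toNNReal ∈ noiseClass M₂ := by
  refine ⟨inferInstance, memLp_id_gaussianReal 2, integral_id_gaussianReal, ?_⟩
  have h := variance_id_gaussianReal (μ := 0) (v := M₂.toNNReal)
  rw [variance_of_integral_eq_zero aemeasurable_id integral_id_gaussianReal] at h
  exact (h.trans (Real.coe_toNNReal _ hM₂.le)).le

variable [TopologicalSpace T]

/-- Nonnegativity of `μ 0 ≤ A` excludes `A < 0`, and `A = 0` would force `γ 0 ≤ 0`. -/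
theorem ProcessClass.const_pos (h : ProcessClass hH H₀ ρ s M A F) : 0 < A := by
  obtain ⟨μ, φ, γ, hφ, hμ, hγ, hγρ⟩ := h.decay
  have h0 := hμ 0
  have hμ0 := eigenvalue_nonneg hφ 0
  simp only [Nat.cast_zero, zero_add, Real.one_rpow, mul_one] at h0
  rcases lt_trichotomy A 0 with hA | hA | hA
  · linarith
  · have := (hγρ 0).2
    rw [hA, zero_mul] at this
    exact absurd (hγ.1 0) (not_lt.2 this)
  · exact hA

/-- The decay condition refers to some eigensystem of `C`, possibly not `ψ`; uniqueness of the
ordered eigenvalues transfers it. -/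
theorem commonClass.exists_eigenvalues (h : F ∈ commonClass hH H₀ ρ ψ s M A) :
    ∃ μ : ℕ → ℝ, IsEigenSystem (covOp F) μ ψ ∧ (∀ k, 0 < μ k) ∧
      ∀ k : ℕ, A⁻¹ * ((k : ℝ) + 1) ^ (-2 * s) ≤ μ k ∧ μ k ≤ A * ((k : ℝ) + 1) ^ (-2 * s) := by
  obtain ⟨hF, μ, hμ⟩ := h
  obtain ⟨μ', φ, -, hφ, hμ', -, -⟩ := hF.decay
  have e : μ = μ' := funext fun k => le_antisymm
    (hμ.eigenvalue_le hφ (eigenvalue_nonneg hφ) k) (hφ.eigenvalue_le hμ (eigenvalue_nonneg hμ) k)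
  refine ⟨μ, hμ, fun k => ?_, e ▸ hμ'⟩
  rw [e]
  exact lt_of_lt_of_le (mul_pos (inv_pos.2 hF.const_pos) (by positivity)) (hμ' k).1

theorem ProcessClass.nullSpace_eq_bot (h : ProcessClass hH H₀ ρ s M A F) : H₀ = ⊥ := by
  obtain ⟨μ, φ, γ, -, -, hγ, -⟩ := h.decay
  exact FLR.nullSpace_eq_bot h.nondegenerate hγ

variable [SecondCountableTopology (L2 τ)]

/-- The class is invariant under centering. -/
theorem commonClass.exists_centered (h : F ∈ commonClass hH H₀ ρ ψ s M A) :
    ∃ F' ∈ commonClass hH H₀ ρ ψ s M A, ∫ x, x ∂F' = 0 := by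
  obtain ⟨hF, hψ⟩ := h
  have := hF.prob
  set m : L2 τ := ∫ x, x ∂F
  set F' := F.map fun x => -m + x with hF'
  have hmeas : Measurable fun x : L2 τ => -m + x := by fun_prop
  have hcov : covOp F' = covOp F := by
    unfold covOp
    rw [hF', covarianceBilin_map_const_add]
  have hint : Integrable (fun x : L2 τ => x) F := hF.memLp.integrable one_le_two
  have hmean : ∫ x, x ∂F' = 0 := by
    have h1 := integral_map (μ := F) hmeas.aemeasurable
      (f := fun x : L2 τ => x) aestronglyMeasurable_id
    rw [hF', h1, integral_add (integrable_const _) hint]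
    simp [m]
  refine ⟨F', ⟨⟨?_, ?_, ?_, ?_, ?_, ?_⟩, ?_⟩, hmean⟩
  · exact Measure.isProbabilityMeasure_map hmeas.aemeasurable
  · rw [hF', memLp_map_measure_iff aestronglyMeasurable_id hmeas.aemeasurable]
    exact (memLp_const (-m)).add hF.memLp
  · rw [hcov]; exact hF.continuous_cov
  · rw [hcov]; exact hF.nondegenerate
  · intro f
    obtain ⟨h1, h2⟩ := hF.fourth_moment f
    have e : ∀ x, ⟪f, -m + x⟫ = ⟪f, x - m⟫ := fun x => by rw [sub_eq_neg_add]
    rw [hmean]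
    simp only [sub_zero]
    rw [hF', integrable_map_measure (by fun_prop) hmeas.aemeasurable,
      integral_map hmeas.aemeasurable (by fun_prop),
      integral_map hmeas.aemeasurable (by fun_prop)]
    simp only [Function.comp_def, e]
    exact ⟨h1, h2⟩
  · rw [hcov]; exact hF.decay
  · rw [hcov]; exact hψ

end Classes

/-! ### Lower bound: choice of the hypercube -/

section Minimax

variable {T : Type*} [MeasurableSpace T] [TopologicalSpace T] {τ : Measure T}
  [SecondCountableTopology (L2 τ)]
  {H : Type*} [NormedAddCommGroup H] [InnerProductSpace ℝ H] [CompleteSpace H] [RKHS ℝ H T ℝ]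
  {hH : ∀ f : H, MemLp (f : T → ℝ) 2 τ} {H₀ : Submodule ℝ H} [H₀.HasOrthogonalProjection]
  {ρ : ℕ → ℝ} {ψ : ℕ → L2 τ} {r s M A c₁ c₂ M₂ B : ℝ} {ι : H →L[ℝ] L2 τ}

theorem exists_lower_bound (hι : ∀ f, ι f = toL2 hH f) (hψ : IsEigenSystem (ι ∘L ι.adjoint) ρ ψ)
    (hr : 1 / 2 < r) (hs : 1 / 2 < s) (hρpos : ∀ k, 0 < ρ k) (hc₁ : 0 < c₁)
    (hρ₁ : ∀ k : ℕ, c₁ * ((k : ℝ) + 1) ^ (-2 * r) ≤ ρ k)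
    (hρ₂ : ∀ k : ℕ, ρ k ≤ c₂ * ((k : ℝ) + 1) ^ (-2 * r))
    (α₀ : ℝ) (hM₂ : 0 < M₂) (hB : 0 < B) (hne : (commonClass hH H₀ ρ ψ s M A).Nonempty) :
    ∃ δ : ℝ, 0 < δ ∧ ∀ n : ℕ, 0 < n → ∀ b : (Fin n → L2 τ × ℝ) → L2 τ, Measurable b →
      ENNReal.ofReal (1 / 32) ≤ worstProb hH n α₀ (commonClass hH H₀ ρ ψ s M A) (noiseClass M₂)
        {β₀ : H | J H₀ β₀ ≤ B} b (δ * (n : ℝ) ^ (-(2 * r) / (2 * (r + s) + 1))) := by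
  obtain ⟨F₀, hF₀⟩ := hne
  -- Assouad's lemma involves uncentered second moments of `⟪x, ψ k⟫`, which equal `μ k` once `F` is
  -- centered.
  obtain ⟨F, hF, hmean⟩ := commonClass.exists_centered hF₀
  obtain ⟨μ, hμψ, hμpos, hμA⟩ := commonClass.exists_eigenvalues hF
  have hbot := hF.1.nullSpace_eq_bot
  have hFp := hF.1.prob
  have hA := hF.1.const_pos
  have hc₂ : 0 < c₂ := by
    have := (hρpos 0).trans_le (hρ₂ 0)
    simpa using this
  set p := 2 * (r + s) with hp
  have hp1 : 0 < p + 1 := by linarith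
  -- Chosen so that `m ≥ K N` yields `n c_j² μ_{m+j} ≤ 4 M₂`; `K ≥ 1` gives `K ≤ K ^ (p + 1)`.
  set K := max 1 (B * A * c₂ / (4 * M₂)) with hK
  have hK1 : 1 ≤ K := le_max_left _ _
  refine ⟨B * c₁ * (4 * K) ^ (-(2 * r)) / 128, by positivity, fun n hn b hb => ?_⟩
  have hn1 : (1 : ℝ) ≤ n := by exact_mod_cast hn
  set N : ℝ := (n : ℝ) ^ (1 / (p + 1)) with hN
  have hN1 : 1 ≤ N := Real.one_le_rpow hn1 (by positivity)
  have hNp : N ^ (p + 1) = n := by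
    rw [hN, ← Real.rpow_mul (by positivity), one_div_mul_cancel hp1.ne', Real.rpow_one]
  have hNr : (n : ℝ) ^ (-(2 * r) / (p + 1)) = N ^ (-(2 * r)) := by
    rw [hN, ← Real.rpow_mul (by positivity)]; congr 1; ring
  set m := ⌈K * N⌉₊ with hm
  have hKN : 1 ≤ K * N := one_le_mul_of_one_le_of_one_le hK1 hN1
  have hmpos : 0 < m := Nat.ceil_pos.2 (by linarith)
  have hm1 : (1 : ℝ) ≤ m := by exact_mod_cast hmpos
  have hmlow : K * N ≤ m := Nat.le_ceil _
  have hmup : (m : ℝ) ≤ 2 * (K * N) := by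
    have := Nat.ceil_lt_add_one (show 0 ≤ K * N by linarith)
    linarith
  -- Each active coordinate uses `B / m` of the penalty budget `B`. The block `m, …, 2m - 1` keeps
  -- all `ρ` and `μ` involved of the same order as at `m`.
  set c : Fin m → ℝ := fun j => √(B * ρ (m + j) / m) with hc
  have hc2 : ∀ j, c j ^ 2 = B * ρ (m + j) / m := fun j =>
    Real.sq_sqrt (by have := hρpos (m + j); positivity)
  have hinj : Function.Injective fun j : Fin m => m + (j : ℕ) := fun i j h =>
    Fin.ext (Nat.add_left_cancel h)
  set κ := B * (c₁ * (2 * m) ^ (-(2 * r))) / m with hκ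
  have hκpos : 0 < κ := by positivity
  have hidx : ∀ j : Fin m, ((m + (j : ℕ) : ℕ) : ℝ) + 1 ≤ 2 * m := by
    intro j
    have : m + (j : ℕ) + 1 ≤ 2 * m := by omega
    exact_mod_cast this
  have hκc : ∀ j, κ ≤ c j ^ 2 := by
    intro j
    rw [hc2, hκ]
    have h1 : (2 * (m : ℝ)) ^ (-(2 * r)) ≤ (((m + (j : ℕ) : ℕ) : ℝ) + 1) ^ (-2 * r) := by
      rw [show -2 * r = -(2 * r) by ring]
      exact Real.rpow_le_rpow_of_nonpos (by positivity) (hidx j) (by linarith)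
    have h2 := (mul_le_mul_of_nonneg_left h1 hc₁.le).trans (hρ₁ (m + j))
    gcongr
  have hdist : ∀ j, n * ∫ x, ⟪x, c j • ψ (m + j)⟫ ^ 2 ∂F ≤ 4 * (M₂.toNNReal : ℝ) := by
    intro j
    rw [integral_inner_eigenfunction_sq hF.1.memLp hmean hμψ, hc2, Real.coe_toNNReal _ hM₂.le]
    set x : ℝ := ((m + (j : ℕ) : ℕ) : ℝ) + 1 with hx
    have hx0 : 0 < x := by positivity
    have hmx : (m : ℝ) ≤ x := by
      rw [hx]; push_cast
      have : (0 : ℝ) ≤ (j : ℕ) := Nat.cast_nonneg _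
      linarith
    have h1 : ρ (m + j) * μ (m + j) ≤ c₂ * A * (m : ℝ) ^ (-p) := by
      have h2 := mul_le_mul (hρ₂ (m + j)) (hμA (m + j)).2 (hμpos _).le
        ((hρpos _).le.trans (hρ₂ (m + j)))
      refine h2.trans ?_
      have h3 : x ^ (-p) ≤ (m : ℝ) ^ (-p) :=
        Real.rpow_le_rpow_of_nonpos (by linarith) hmx (by linarith)
      have e : c₂ * x ^ (-2 * r) * (A * x ^ (-2 * s)) = c₂ * A * x ^ (-p) := by
        rw [show -p = -2 * r + -2 * s by rw [hp]; ring, Real.rpow_add hx0]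
        ring
      rw [← hx, e]
      gcongr
    have h4 : B * A * c₂ * n ≤ 4 * M₂ * (m : ℝ) ^ (p + 1) := by
      have h5 : (K * N) ^ (p + 1) ≤ (m : ℝ) ^ (p + 1) :=
        Real.rpow_le_rpow (by linarith) hmlow hp1.le
      rw [Real.mul_rpow (by linarith) (by linarith), hNp] at h5
      have h6 : K ≤ K ^ (p + 1) := by
        have := Real.rpow_le_rpow_of_exponent_le hK1 (show 1 ≤ p + 1 by linarith)
        rwa [Real.rpow_one] at this
      have h7 : B * A * c₂ ≤ 4 * M₂ * K := by
        have : B * A * c₂ / (4 * M₂) ≤ K := le_max_right _ _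
        rw [div_le_iff₀ (by positivity)] at this
        linarith
      calc B * A * c₂ * n ≤ 4 * M₂ * K * n := by gcongr
        _ ≤ 4 * M₂ * K ^ (p + 1) * n := by gcongr
        _ = 4 * M₂ * (K ^ (p + 1) * n) := by ring
        _ ≤ _ := by gcongr
    have hm0 : (0 : ℝ) < m := by linarith
    have e2 : (m : ℝ) ^ (p + 1) = m ^ p * m := by rw [Real.rpow_add hm0, Real.rpow_one]
    calc (n : ℝ) * (B * ρ (m + j) / m * μ (m + j)) = n * B / m * (ρ (m + j) * μ (m + j)) := by ring
      _ ≤ n * B / m * (c₂ * A * (m : ℝ) ^ (-p)) := by gcongr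
      _ = B * A * c₂ * n / (m : ℝ) ^ (p + 1) := by
        rw [Real.rpow_neg hm0.le, e2]
        have : (m : ℝ) ^ p ≠ 0 := (Real.rpow_pos_of_pos hm0 _).ne'
        field_simp
      _ ≤ 4 * M₂ := by
        rw [div_le_iff₀ (Real.rpow_pos_of_pos hm0 _)]
        exact h4
  have hv : M₂.toNNReal ≠ 0 := (Real.toNNReal_pos.2 hM₂).ne'
  obtain ⟨θ, hθ⟩ := dataLaw_hypercube hmpos α₀ F hF.1.memLp hv
    (hμψ.orthonormal.comp _ hinj) c hκpos hκc hdist hb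
  obtain ⟨β, hβ, hβn⟩ := exists_preimage hψ hρpos hinj fun j => if θ j then c j else 0
  have hβB : J H₀ β ≤ B := by
    rw [J_bot hbot, hβn]
    have : ∀ j : Fin m, (if θ j then c j else 0) ^ 2 / ρ (m + j) ≤ B / m := by
      intro j
      have hρj := hρpos (m + j)
      have hm0 : (0 : ℝ) < m := by linarith
      split_ifs
      · rw [hc2]
        apply le_of_eq
        field_simp
      · rw [zero_pow two_ne_zero, zero_div]; positivity
    refine (Finset.sum_le_sum fun j _ => this j).trans (le_of_eq ?_)
    simp only [Finset.sum_const, Finset.card_univ, Fintype.card_fin, nsmul_eq_mul]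
    field_simp
  have hβ' : toL2 hH β = ∑ j : Fin m, (if θ j then c j else 0) • ψ (m + j) := by
    rw [← hι, hβ]
  have hthr : B * c₁ * (4 * K) ^ (-(2 * r)) / 128 * (n : ℝ) ^ (-(2 * r) / (p + 1))
      ≤ κ * m / 128 := by
    have hm0 : (0 : ℝ) < m := by linarith
    have h1 : (4 * K * N) ^ (-(2 * r)) ≤ (2 * (m : ℝ)) ^ (-(2 * r)) :=
      Real.rpow_le_rpow_of_nonpos (by positivity) (by linarith) (by linarith)
    rw [Real.mul_rpow (by positivity) (by positivity)] at h1
    have e : κ * m / 128 = B * c₁ / 128 * (2 * (m : ℝ)) ^ (-(2 * r)) := by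
      rw [hκ]; field_simp
    rw [hNr, e]
    calc B * c₁ * (4 * K) ^ (-(2 * r)) / 128 * N ^ (-(2 * r))
        = B * c₁ / 128 * ((4 * K) ^ (-(2 * r)) * N ^ (-(2 * r))) := by ring
      _ ≤ _ := by gcongr
  have hprob : ENNReal.ofReal (1 / 32) ≤
      dataLaw n α₀ (toL2 hH β) F (gaussianReal 0 M₂.toNNReal)
        {z | B * c₁ * (4 * K) ^ (-(2 * r)) / 128 * (n : ℝ) ^ (-(2 * r) / (p + 1))
          < ‖b z - toL2 hH β‖ ^ 2} := by
    rw [hβ']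
    refine (ENNReal.ofReal_le_of_le_toReal hθ).trans (measure_mono fun z hz => ?_)
    exact lt_of_le_of_lt hthr hz
  unfold worstProb
  exact hprob.trans ((((le_iSup₂ (f := fun (β₀ : H) (_ : β₀ ∈ {β₀ : H | J H₀ β₀ ≤ B}) =>
    dataLaw n α₀ (toL2 hH β₀) F (gaussianReal 0 M₂.toNNReal)
      {z | B * c₁ * (4 * K) ^ (-(2 * r)) / 128 * (n : ℝ) ^ (-(2 * r) / (p + 1))
          < ‖b z - toL2 hH β₀‖ ^ 2}) β hβB).trans
    (le_iSup₂ (f := fun (G : Measure ℝ) (_ : G ∈ noiseClass M₂) =>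
      ⨆ β₀ ∈ {β₀ : H | J H₀ β₀ ≤ B}, dataLaw n α₀ (toL2 hH β₀) F G
      {z | B * c₁ * (4 * K) ^ (-(2 * r)) / 128 * (n : ℝ) ^ (-(2 * r) / (p + 1))
          < ‖b z - toL2 hH β₀‖ ^ 2}) _ (gaussian_mem_noiseClass hM₂))).trans
    (le_iSup₂ (f := fun (F : Measure (L2 τ)) (_ : F ∈ commonClass hH H₀ ρ ψ s M A) =>
      ⨆ G ∈ noiseClass M₂, ⨆ β₀ ∈ {β₀ : H | J H₀ β₀ ≤ B}, dataLaw n α₀ (toL2 hH β₀) F G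
      {z | B * c₁ * (4 * K) ^ (-(2 * r)) / 128 * (n : ℝ) ^ (-(2 * r) / (p + 1))
          < ‖b z - toL2 hH β₀‖ ^ 2}) F hF)))

end Minimax

/-! ### Upper bound: tuning the risk bound -/

section UpperRate

variable {T : Type*} [MeasurableSpace T] [TopologicalSpace T] {τ : Measure T}
  [SecondCountableTopology (L2 τ)]
  {H : Type*} [NormedAddCommGroup H] [InnerProductSpace ℝ H] [CompleteSpace H] [RKHS ℝ H T ℝ]
  {hH : ∀ f : H, MemLp (f : T → ℝ) 2 τ} {H₀ : Submodule ℝ H} [H₀.HasOrthogonalProjection]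
  {ρ : ℕ → ℝ} {ψ : ℕ → L2 τ} {r s M A c₂ M₂ B : ℝ} {ι : H →L[ℝ] L2 τ}

/-- The regularized slope attains the rate, with explicit dependence on `n` and on the constant
`D` in front of the rate. -/
theorem exists_upper_bound (hι : ∀ f, ι f = toL2 hH f) (hψ : IsEigenSystem (ι ∘L ι.adjoint) ρ ψ)
    (hr : 1 / 2 < r) (hs : 1 / 2 < s) (hρpos : ∀ k, 0 < ρ k)
    (hρ₂ : ∀ k : ℕ, ρ k ≤ c₂ * ((k : ℝ) + 1) ^ (-2 * r))
    (α₀ : ℝ) (hM₂ : 0 < M₂) (hB : 0 < B) (hA : 0 < A) (hbot : H₀ = ⊥)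
    {lam : ℕ → ℝ} (hlam : ∀ n, 0 < lam n) {a₁ a₂ : ℝ} (ha₁ : 0 < a₁) (ha₂ : 0 < a₂)
    (hlam₁ : ∀ n : ℕ, 0 < n →
      a₁ * (n : ℝ) ^ (-(2 * (r + s)) / (2 * (r + s) + 1)) ≤ lam n)
    (hlam₂ : ∀ n : ℕ, 0 < n →
      lam n ≤ a₂ * (n : ℝ) ^ (-(2 * (r + s)) / (2 * (r + s) + 1)))
    {b : (n : ℕ) → (Fin n → L2 τ × ℝ) → H}
    (hb : ∀ n z, IsRegularizedSlope hH H₀ n (lam n) z (b n z)) :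
    ∃ K₁ K₂ D₀ : ℝ, ∀ n : ℕ, 0 < n → ∀ D, D₀ ≤ D →
      worstProb hH n α₀ (commonClass hH H₀ ρ ψ s M A) (noiseClass M₂)
        {β₀ : H | J H₀ β₀ ≤ B} (fun z => toL2 hH (b n z))
        (D * (n : ℝ) ^ (-(2 * r) / (2 * (r + s) + 1)))
      ≤ ENNReal.ofReal (K₁ * (n : ℝ) ^ (2 / (2 * (r + s) + 1) - 1)) + ENNReal.ofReal (K₂ / D) := by
  have hc₂ : 0 < c₂ := by
    have := (hρpos 0).trans_le (hρ₂ 0)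
    simpa using this
  set p := 2 * (r + s) with hp
  have hp0 : 0 < p := by linarith
  have hp1 : 0 < p + 1 := by linarith
  set l₁ := a₂ ^ (-(1 / p)) with hl₁
  set l₂ := a₁ ^ (-(1 / p)) with hl₂
  have hl₁0 : 0 < l₁ := Real.rpow_pos_of_pos ha₂ _
  have hl₂0 : 0 < l₂ := Real.rpow_pos_of_pos ha₁ _
  set κ₀ := min A⁻¹ c₂⁻¹ with hκ₀
  have hκ₀0 : 0 < κ₀ := lt_min (inv_pos.2 hA) (inv_pos.2 hc₂)
  set C := 4 * max 1 (A * c₂) with hC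
  have hC0 : 0 < C := by positivity
  set q := κ₀ * l₁ ^ (2 * r) with hq
  have hq0 : 0 < q := by positivity
  have hM0 : 0 ≤ max M 1 := le_max_of_le_right zero_le_one
  refine ⟨16 * (max M 1 * (1 + C * l₂) ^ 2), M₂ * (1 + C * l₂) * l₂ ^ p * 128 / q,
    32 * B / q, fun n hn D hD => ?_⟩
  have hn1 : (1 : ℝ) ≤ n := by exact_mod_cast hn
  have hn0 : (0 : ℝ) < n := by linarith
  have hD0 : 0 < D := lt_of_lt_of_le (by positivity) hD
  set N : ℝ := (n : ℝ) ^ (1 / (p + 1)) with hN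
  have hN1 : 1 ≤ N := Real.one_le_rpow hn1 (by positivity)
  have hN0 : 0 < N := by linarith
  have hNpow : ∀ t : ℝ, (n : ℝ) ^ (t / (p + 1)) = N ^ t := by
    intro t
    rw [hN, ← Real.rpow_mul hn0.le]; congr 1; ring
  have hNp : N ^ (p + 1) = n := by
    rw [← hNpow, div_self hp1.ne', Real.rpow_one]
  -- `L` is the index where `μ k` and `lam n / ρ k` have the same order; it lies between `l₁ N` and
  -- `l₂ N`.
  set L := lam n ^ (-(1 / p)) with hL
  have hL0 : 0 < L := Real.rpow_pos_of_pos (hlam n) _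
  have hlamL : lam n = L ^ (-p) := by
    rw [hL, ← Real.rpow_mul (hlam n).le, neg_mul_neg, one_div_mul_cancel hp0.ne', Real.rpow_one]
  have hpowlam : ∀ a : ℝ, 0 < a → (a * N ^ (-p)) ^ (-(1 / p)) = a ^ (-(1 / p)) * N := by
    intro a ha
    rw [Real.mul_rpow ha.le (by positivity), ← Real.rpow_mul hN0.le, neg_mul_neg,
      mul_one_div_cancel hp0.ne', Real.rpow_one]
  have hnexp : -(1 / p) ≤ 0 := neg_nonpos.2 (by positivity)
  have hL1 : l₁ * N ≤ L := by
    rw [hl₁, ← hpowlam a₂ ha₂, hL, ← hNpow]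
    exact Real.rpow_le_rpow_of_nonpos (hlam n) (hlam₂ n hn) hnexp
  have hL2 : L ≤ l₂ * N := by
    rw [hl₂, ← hpowlam a₁ ha₁, hL, ← hNpow]
    exact Real.rpow_le_rpow_of_nonpos (by positivity) (hlam₁ n hn) hnexp
  -- The noise level `ζ = t L^{-p}` takes half of the allowed error, `64 t = D q / 2`; the penalty
  -- term `16 B` fits in the other half because `D ≥ 32 B / q`.
  set t := D * q / 128 with ht
  have ht0 : 0 < t := by positivity
  have htB : 32 * B ≤ D * q := by rwa [div_le_iff₀ hq0] at hD
  have hSN : 1 + C * L ≤ (1 + C * l₂) * N := by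
    have := mul_le_mul_of_nonneg_left hL2 hC0.le
    nlinarith
  have hS0 : 0 ≤ 1 + C * L := by positivity
  unfold worstProb
  refine iSup₂_le fun F hF => iSup₂_le fun G hG => iSup₂_le fun β₀ hβ₀ => ?_
  obtain ⟨μ, hμψ, hμpos, hμA⟩ := commonClass.exists_eigenvalues hF
  have hFp := hF.1.prob
  have hnorm : ‖β₀‖ ^ 2 ≤ B := by
    rw [← J_bot hbot]; exact hβ₀
  obtain ⟨hS1, hS2⟩ := effective_dimension_bound (A := A) (c := c₂) (r := r) (s := s) hμpos hρpos
    (fun k => (hμA k).2) hρ₂ hL0 (by linarith)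
  have hκle := weight_lower_bound (A := A) (c := c₂) (r := r) (s := s) hρpos hμpos hA hc₂
    (fun k => (hμA k).1) hρ₂ hL0 (by linarith) (by linarith)
  rw [← hp, ← hlamL] at hS1 hS2 hκle
  have hu : (κ₀ * L ^ (-(2 * s)))⁻¹ * (64 * (t * L ^ (-p)) + 16 * (lam n * B))
      ≤ D * (n : ℝ) ^ (-(2 * r) / (p + 1)) := by
    have e1 : (κ₀ * L ^ (-(2 * s)))⁻¹ * (64 * (t * L ^ (-p)) + 16 * (lam n * B))
        = κ₀⁻¹ * (64 * t + 16 * B) * L ^ (-(2 * r)) := by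
      have e2 : L ^ (-p) = L ^ (-(2 * r)) * L ^ (-(2 * s)) := by
        rw [← Real.rpow_add hL0, hp]; congr 1; ring
      have h0 : L ^ (-(2 * s)) ≠ 0 := (Real.rpow_pos_of_pos hL0 _).ne'
      rw [hlamL, e2]
      field_simp
    have h1 : L ^ (-(2 * r)) ≤ (l₁ * N) ^ (-(2 * r)) :=
      Real.rpow_le_rpow_of_nonpos (by positivity) hL1 (by linarith)
    have h2 : 64 * t + 16 * B ≤ D * q := by rw [ht]; linarith
    rw [e1, hNpow]
    calc κ₀⁻¹ * (64 * t + 16 * B) * L ^ (-(2 * r))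
        ≤ κ₀⁻¹ * (D * q) * (l₁ * N) ^ (-(2 * r)) := by gcongr
      _ = D * N ^ (-(2 * r)) := by
        rw [hq, Real.mul_rpow hl₁0.le hN0.le, Real.rpow_neg hl₁0.le]
        have h0 : l₁ ^ (2 * r) ≠ 0 := (Real.rpow_pos_of_pos hl₁0 _).ne'
        field_simp
  have hrisk := ridge_risk_bound hψ hρpos hμpos hF.1.memLp hμψ hF.1.fourth_moment hG hn
    (hlam n) (ζ := t * L ^ (-p)) (by positivity) (κ := κ₀ * L ^ (-(2 * s))) (by positivity)
    hκle hS1 hS2 α₀ hnorm (b := b n) (fun z => by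
      obtain ⟨α, hα⟩ := hb n z
      refine ⟨α, fun α' β' => ?_⟩
      have := hα α' β'
      simp only [criterion, J_bot hbot, ← hι] at this
      exact this) hu
  simp only [hι] at hrisk
  refine hrisk.trans (add_le_add (ENNReal.ofReal_le_ofReal ?_) (ENNReal.ofReal_le_ofReal ?_))
  · have e1 : (n : ℝ) ^ (2 / (p + 1) - 1) = N ^ 2 / n := by
      rw [Real.rpow_sub hn0, Real.rpow_one, hNpow, ← Real.rpow_natCast N 2]
      norm_num
    rw [e1]
    calc 16 * (max M 1 * (1 + C * L) ^ 2 / n)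
        ≤ 16 * (max M 1 * ((1 + C * l₂) * N) ^ 2 / n) := by gcongr
      _ = _ := by ring
  · have h1 : L ^ p ≤ (l₂ * N) ^ p := Real.rpow_le_rpow hL0.le hL2 hp0.le
    have h2 : M₂ * (1 + C * L) / n / (t * L ^ (-p)) = M₂ * (1 + C * L) * L ^ p / (n * t) := by
      rw [Real.rpow_neg hL0.le]
      field_simp
    rw [h2]
    calc M₂ * (1 + C * L) * L ^ p / (n * t)
        ≤ M₂ * ((1 + C * l₂) * N) * (l₂ * N) ^ p / (n * t) := by gcongr
      _ = M₂ * (1 + C * l₂) * l₂ ^ p / t * (N ^ (p + 1) / n) := by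
        rw [Real.mul_rpow hl₂0.le hN0.le, Real.rpow_add hN0, Real.rpow_one]
        field_simp
      _ = M₂ * (1 + C * l₂) * l₂ ^ p * 128 / q / D := by
        rw [hNp, div_self hn0.ne', ht]
        field_simp

end UpperRate

end FLR

/-! ### The minimax theorem -/

theorem corollary10 {d : ℕ} (T : Set (EuclideanSpace ℝ (Fin d))) (hT : IsCompact T)
    (τ : Measure T) [IsFiniteMeasure τ]
    -- the reproducing kernel Hilbert space `H` of square integrable functions on `T`,
    -- and the finite-dimensional null space `H₀` of the penalty
    {H : Type*} [NormedAddCommGroup H] [InnerProductSpace ℝ H] [CompleteSpace H] [RKHS ℝ H T ℝ]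
    (hH : ∀ f : H, MemLp (f : T → ℝ) 2 τ)
    (H₀ : Submodule ℝ H) [FiniteDimensional ℝ H₀]
    -- the kernel `K` of the complement of `H₀`, its eigenvalues `ρ` and eigenfunctions `ψ`
    (hK : Continuous (Function.uncurry (FLR.penKernel (T := T) H₀)))
    (ρ : ℕ → ℝ) (ψ : ℕ → FLR.L2 τ)
    (hψ : ∃ Kop : FLR.L2 τ →L[ℝ] FLR.L2 τ,
      FLR.IsIntegralOperator τ (FLR.penKernel (T := T) H₀) Kop ∧ FLR.IsEigenSystem Kop ρ ψ)
    (r s : ℝ) (hr : 1 / 2 < r) (hs : 1 / 2 < s)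
    (hρ_pos : ∀ k, 0 < ρ k)
    (hρ : ρ =Θ[atTop] fun k : ℕ => ((k : ℝ) + 1) ^ (-2 * r))
    (α₀ M A M₂ B : ℝ) (hM₂ : 0 < M₂) (hB : 0 < B)
    (hne : (FLR.commonClass hH H₀ ρ ψ s M A).Nonempty) :
    -- lower bound over all estimators
    (∃ δ : ℝ, 0 < δ ∧
      0 < liminf (fun n : ℕ =>
        ⨅ (b : (Fin n → FLR.L2 τ × ℝ) → FLR.L2 τ) (_ : Measurable b),
          FLR.worstProb hH n α₀ (FLR.commonClass hH H₀ ρ ψ s M A) (FLR.noiseClass M₂)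
            {β₀ : H | FLR.J H₀ β₀ ≤ B} b
            (δ * (n : ℝ) ^ (-(2 * r) / (2 * (r + s) + 1)))) atTop) ∧
    -- the regularized estimator is well defined, is an estimator, and attains the rate
    (∀ lam : ℕ → ℝ, (∀ n, 0 < lam n) →
      (lam =Θ[atTop] fun n : ℕ => (n : ℝ) ^ (-(2 * (r + s)) / (2 * (r + s) + 1))) →
      ∃ b : (n : ℕ) → (Fin n → FLR.L2 τ × ℝ) → H,
        (∀ n z β, FLR.IsRegularizedSlope hH H₀ n (lam n) z β ↔ β = b n z) ∧
        (∀ n, Measurable fun z => FLR.toL2 hH (b n z)) ∧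
        Tendsto (fun D : ℝ => limsup (fun n : ℕ =>
          FLR.worstProb hH n α₀ (FLR.commonClass hH H₀ ρ ψ s M A) (FLR.noiseClass M₂)
            {β₀ : H | FLR.J H₀ β₀ ≤ B} (fun z => FLR.toL2 hH (b n z))
            (D * (n : ℝ) ^ (-(2 * r) / (2 * (r + s) + 1)))) atTop) atTop (𝓝 0)) := by
  have : Fact ((2 : ENNReal) ≠ ⊤) := ⟨ENNReal.ofNat_ne_top⟩
  have : SecondCountableTopology (FLR.L2 τ) := Lp.SecondCountableTopology
  have : CompactSpace T := isCompact_iff_compactSpace.1 hT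
  obtain ⟨Kop, hKop, hKψ⟩ := hψ
  obtain ⟨F₀, hF₀⟩ := id hne
  have hbot := hF₀.1.nullSpace_eq_bot
  have hA := hF₀.1.const_pos
  obtain ⟨ι, hι, hfac⟩ := FLR.exists_embedding hH hbot hK hKop
  rw [hfac] at hKψ
  obtain ⟨c₁, c₂, hc₁, hc₂, hρb⟩ := FLR.bounds_of_isTheta hρ hρ_pos fun k => by positivity
  have hρ₁ : ∀ k : ℕ, c₁ * ((k : ℝ) + 1) ^ (-2 * r) ≤ ρ k := fun k => (hρb k).1
  have hρ₂ : ∀ k : ℕ, ρ k ≤ c₂ * ((k : ℝ) + 1) ^ (-2 * r) := fun k =>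
    (hρb k).2 (by positivity)
  refine ⟨?_, fun lam hlam hlamΘ => ?_⟩
  · obtain ⟨δ, hδ, hlow⟩ := FLR.exists_lower_bound (M := M) (A := A) hι hKψ hr hs hρ_pos hc₁ hρ₁ hρ₂
      α₀ hM₂ hB hne
    refine ⟨δ, hδ, lt_of_lt_of_le (b := ENNReal.ofReal (1 / 32)) (by simp) ?_⟩
    refine le_liminf_of_le (by isBoundedDefault) ?_
    filter_upwards [eventually_gt_atTop 0] with n hn
    exact le_iInf₂ fun b hb => hlow n hn b hb
  · obtain ⟨a₁, a₂, ha₁, ha₂, hlamb⟩ := FLR.bounds_of_isTheta hlamΘ hlam fun n => by positivity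
    have hex := fun n => FLR.exists_ridge_estimate ι n (hlam n)
    choose b hbc hb using hex
    have hslope : ∀ n z β, FLR.IsRegularizedSlope hH H₀ n (lam n) z β ↔ β = b n z := by
      intro n z β
      rw [← hb n z β]
      simp only [FLR.IsRegularizedSlope, FLR.criterion, FLR.J_bot hbot, ← hι]
    refine ⟨b, hslope, fun n => ?_, ?_⟩
    · simp_rw [← hι]
      exact (ι.continuous.comp (hbc n)).measurable
    obtain ⟨K₁, K₂, D₀, hup⟩ := FLR.exists_upper_bound (M := M) (A := A) hι hKψ hr hs hρ_pos hρ₂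
      α₀ hM₂ hB hA hbot hlam ha₁ ha₂ (fun n _ => (hlamb n).1)
      (fun n hn => (hlamb n).2 (Real.rpow_pos_of_pos (by exact_mod_cast hn) _).ne')
      (fun n z => (hslope n z _).2 rfl)
    -- The probability that the empirical moments deviate vanishes as `n → ∞`, so the limsup is at
    -- most `K₂ / D`, which tends to `0` with growing `D`.
    have hexp : 2 / (2 * (r + s) + 1) - 1 < 0 := by
      rw [sub_neg, div_lt_one (by linarith)]
      linarith
    have hzero : Tendsto (fun n : ℕ => (n : ℝ) ^ (2 / (2 * (r + s) + 1) - 1)) atTop (𝓝 0) := by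
      have h1 := (tendsto_rpow_neg_atTop (neg_pos.2 hexp)).comp tendsto_natCast_atTop_atTop
      simpa only [neg_neg, Function.comp_def] using h1
    have hlim : ∀ D, D₀ ≤ D → limsup (fun n : ℕ =>
        FLR.worstProb hH n α₀ (FLR.commonClass hH H₀ ρ ψ s M A) (FLR.noiseClass M₂)
          {β₀ : H | FLR.J H₀ β₀ ≤ B} (fun z => FLR.toL2 hH (b n z))
          (D * (n : ℝ) ^ (-(2 * r) / (2 * (r + s) + 1)))) atTop ≤ ENNReal.ofReal (K₂ / D) := by
      intro D hD
      have h1 : Tendsto (fun n : ℕ => ENNReal.ofReal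
          (K₁ * (n : ℝ) ^ (2 / (2 * (r + s) + 1) - 1)) + ENNReal.ofReal (K₂ / D)) atTop
          (𝓝 (ENNReal.ofReal (K₂ / D))) := by
        have h2 := (ENNReal.tendsto_ofReal (hzero.const_mul K₁)).add_const
          (ENNReal.ofReal (K₂ / D))
        simpa using h2
      rw [← h1.limsup_eq]
      refine limsup_le_limsup ?_ (by isBoundedDefault) (by isBoundedDefault)
      filter_upwards [eventually_gt_atTop 0] with n hn
      exact hup n hn D hD
    have hK₂ : Tendsto (fun D : ℝ => ENNReal.ofReal (K₂ / D)) atTop (𝓝 0) := by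
      have := ENNReal.tendsto_ofReal (tendsto_const_nhds (x := K₂) |>.div_atTop tendsto_id)
      simpa using this
    refine tendsto_of_tendsto_of_tendsto_of_le_of_le' tendsto_const_nhds hK₂
      (Eventually.of_forall fun D => zero_le) ?_
    filter_upwards [eventually_ge_atTop D₀] with D hD
    exact hlim D hD
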